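/- Let $\Omega=(l,r)\subset\mathbb R$ be a bounded open interval, $\beta\in\mathbb R\setminus\{0\}$ a constant velocity, $f,u_h\in L^2(\Omega)$. Write $(v,w)_D=\int_D vw$ and $\|v\|_D=\sqrt{(v,v)_D}$. For an open interval $D$, the outward normal $n$ is $-1$ at its left end and $+1$ at its right end; $\partial_-D$ and $\partial_+D$ are the sets of endpoints with $\beta n<0$ and $\beta n>0$ (inflow and outflow). Let $H^1_+(D)=\{v\in H^1(D): v=0 \text{ on } \partial_+D\}$ and $$\langle\mathcal R(u_h),v\rangle=(f,v)_\Omega+(u_h,\beta\nabla v)_\Omega\quad (v\in H^1_+(\Omega)),\qquad \|\mathcal R(u_h)\|_{\beta;\,H^1_+(\Omega)'}=\sup_{v\in H^1_+(\Omega)\setminus\{0\}}\frac{\langle\mathcal R(u_h),v\rangle}{\|\beta\nabla v\|_\Omega}.$$ Let $l=x_0<x_1<\dots<x_n=r$ be a mesh of $\Omega$ with vertex set $\mathcal V_h$. For $a\in\mathcal V_h$, let $\psi_a$ be the hat function (continuous, affine on each element, $1$ at $a$ and $0$ at the other vertices), and let $\omega_a$ be the open patch of the elements containing $a$, with diameter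 $h_{\omega_a}$. Let $Y_a=H^1_+(\omega_a)$ if $a\in\partial_-\Omega$ and $Y_a=H^1_0(\omega_a)$ otherwise, and $$\|\mathcal R(u_h)\|_{Y_a'}=\sup_{v\in Y_a\setminus\{0\}}\frac{\langle\mathcal R(u_h),v\rangle}{\|\beta\nabla v\|_{\omega_a}},$$ where $v$ is extended by zero to $\Omega$. Let $C_{{\rm PF},\omega_a}$ be the best constant $C>0$ such that $\|v-\bar v\|_{\omega_a}\le h_{\omega_a}C\|\nabla v\|_{\omega_a}$ for all $v\in H^1(\omega_a)$ with mean value $\bar v$ over $\omega_a$, if $a\notin\partial_+\Omega$, and such that $\|v\|_{\omega_a}\le h_{\omega_a}C\|\nabla v\|_{\omega_a}$ for all $v\in H^1_+(\omega_a)$, if $a\in\partial_+\Omega$. Let $$C_{\rm cont,PF}=\max_{a\in\mathcal V_h}\bigl(1+C_{{\rm PF},\omega_a}h_{\omega_a}\|\nabla\psi_a\|_\infty\bigr).$$ Then the best constants $C_{{\rm PF},\omega_a}$ exist and are at most $1$, the suprema above are finite, and the following holds. (a) If $\langle\mathcal R(u_h),\psi_a\rangle=0$ for all vertices $a$ in $\Omega\cup\partial_-\Omega$,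 then $$\|\mathcal R(u_h)\|^2_{\beta;\,H^1_+(\Omega)'}\le 2\,C_{\rm cont,PF}^2\sum_{a\in\mathcal V_h}\|\mathcal R(u_h)\|^2_{Y_a'}.$$ (b) Always (without the orthogonality in (a)), $$\sum_{a\in\mathcal V_h}\|\mathcal R(u_h)\|^2_{Y_a'}\le 2\,\|\mathcal R(u_h)\|^2_{\beta;\,H^1_+(\Omega)'}.$$ -/

import Mathlib

open MeasureTheory Set
open scoped ContDiff

noncomputable section

namespace Advection

/-! ### Function spaces on a bounded open interval `(l, r)` -/

/-- The inner product `(v, w)_D = ∫_D v w` on `D = (l, r)`. -/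
def ip (l r : ℝ) (v w : ℝ → ℝ) : ℝ := ∫ x in Ioo l r, v x * w x

/-- The norm `‖v‖_D = √(v, v)_D` of `L²(l, r)`. -/
def l2norm (l r : ℝ) (v : ℝ → ℝ) : ℝ := Real.sqrt (ip l r v v)

/-- `v ∈ L²(l, r)`. -/
def MemL2 (l r : ℝ) (v : ℝ → ℝ) : Prop := MemLp v 2 (volume.restrict (Ioo l r))

/-- `g` is the distributional derivative of `v` on `(l, r)`, tested against `C_c^∞(l, r)`. -/
def IsWeakDeriv (l r : ℝ) (v g : ℝ → ℝ) : Prop :=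
  ∀ φ : ℝ → ℝ, ContDiff ℝ ∞ φ → HasCompactSupport φ → tsupport φ ⊆ Ioo l r →
    ip l r v (deriv φ) = -ip l r g φ

/-- `v ∈ H¹(l, r)` with weak derivative `∇v = g`
(which is determined by `v` up to equality almost everywhere). -/
def MemH1 (l r : ℝ) (v g : ℝ → ℝ) : Prop :=
  MemL2 l r v ∧ MemL2 l r g ∧ IsWeakDeriv l r v g

/-- The trace of `v` at the endpoint `c` of `(l, r)`, i.e. the value at `c` of the representative
of `v` that is continuous on `[l, r]`, exists and is zero. -/
def ZeroTrace (l r : ℝ) (v : ℝ → ℝ) (c : ℝ) : Prop :=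
  ∃ w : ℝ → ℝ, ContinuousOn w (Icc l r) ∧ v =ᵐ[volume.restrict (Ioo l r)] w ∧ w c = 0

/-- Inflow boundary of `(l, r)`: the points of `{l, r}` where `β · n < 0`; the outward
normal is `-1` at `l` and `1` at `r`. -/
def inflow (β l r : ℝ) : Set ℝ := {c | (c = l ∧ β * (-1) < 0) ∨ (c = r ∧ β * 1 < 0)}

/-- Outflow boundary of `(l, r)`: the points of `{l, r}` where `β · n > 0`. -/
def outflow (β l r : ℝ) : Set ℝ := {c | (c = l ∧ 0 < β * (-1)) ∨ (c = r ∧ 0 < β * 1)}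

/-- `v ∈ H¹₊(l, r)` (zero trace on the outflow boundary), with `∇v = g`. -/
def MemH1plus (β l r : ℝ) (v g : ℝ → ℝ) : Prop :=
  MemH1 l r v g ∧ ∀ c ∈ outflow β l r, ZeroTrace l r v c

/-- `v ∈ H¹₀(l, r)` (zero trace on the whole boundary), with `∇v = g`. -/
def MemH1zero (l r : ℝ) (v g : ℝ → ℝ) : Prop :=
  MemH1 l r v g ∧ ZeroTrace l r v l ∧ ZeroTrace l r v r

/-- The mean value of `v` over `(l, r)`. -/
def mean (l r : ℝ) (v : ℝ → ℝ) : ℝ := ip l r v (fun _ => 1) / (r - l)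

/-! ### The residual and its dual norm -/

/-- The residual `⟨R(u_h), v⟩ = (f, v) + (u_h, β ∇v)` on `Ω = (l, r)`, for `∇v = g`. -/
def residual (β l r : ℝ) (f u v g : ℝ → ℝ) : ℝ :=
  ip l r f v + ip l r u (fun x => β * g x)

/-- The quotients `⟨R(u_h), v⟩ / ‖β ∇v‖`, `v ∈ H¹₊(Ω)`, `v ≠ 0`. -/
def globalQuotients (β l r : ℝ) (f u : ℝ → ℝ) : Set ℝ :=
  {t | ∃ v g : ℝ → ℝ, MemH1plus β l r v g ∧ ¬ v =ᵐ[volume.restrict (Ioo l r)] 0 ∧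
    t = residual β l r f u v g / l2norm l r (fun x => β * g x)}

/-- The velocity-scaled dual norm of the residual on `H¹₊(Ω)`. -/
def globalDualNorm (β l r : ℝ) (f u : ℝ → ℝ) : ℝ := sSup (globalQuotients β l r f u)

/-! ### Meshes, patches and hat functions -/

/-- A mesh of `(l, r)`: vertices `l = x 0 < x 1 < ⋯ < x n = r` (values `x i`, `i > n`, are not
used). Its elements are the intervals `[x i, x (i + 1)]`, `i < n`. -/
structure Mesh (l r : ℝ) where
  n : ℕ
  x : ℕ → ℝ
  strictMonoOn : StrictMonoOn x (Set.Iic n)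
  x_zero : x 0 = l
  x_last : x n = r

namespace Mesh

variable {l r : ℝ} (M : Mesh l r)

/-- Left end of the patch of the `i`-th vertex: `x (i - 1)` if `i ≥ 1`, and `x 0` if `i = 0`. -/
def left (i : ℕ) : ℝ := M.x (i - 1)

/-- Right end of the patch of the `i`-th vertex: `x (i + 1)` if `i < n`, and `x n` if `i = n`.
The patch subdomain is the open interval between its left end and its right end. -/
def right (i : ℕ) : ℝ := M.x (min (i + 1) M.n)

/-- The hat function of the `i`-th vertex: affine on each element, `1` at `x i` and `0` at all
other vertices. -/
def hat (i : ℕ) (t : ℝ) : ℝ :=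
  if t = M.x i then 1
  else if M.left i < t ∧ t < M.x i then (t - M.left i) / (M.x i - M.left i)
  else if M.x i < t ∧ t < M.right i then (M.right i - t) / (M.right i - M.x i)
  else 0

/-- `‖∇ψ_a‖_∞`, the essential supremum norm on `Ω`. The hat function is affine off the finitely
many vertices, so that `deriv` is its weak derivative on `Ω`. -/
def hatGradSup (i : ℕ) : ℝ :=
  (eLpNorm (deriv (M.hat i)) ⊤ (volume.restrict (Ioo l r))).toReal

/-- `v` belongs to the patchwise space of the `i`-th vertex `a`, with `∇v = g`: this space is
`H¹₊(ω_a)` if `a` lies on the inflow boundary of `Ω`, and `H¹₀(ω_a)` otherwise. -/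
def MemPatchSpace (β : ℝ) (i : ℕ) (v g : ℝ → ℝ) : Prop :=
  (M.x i ∈ inflow β l r → MemH1plus β (M.left i) (M.right i) v g) ∧
  (M.x i ∉ inflow β l r → MemH1zero (M.left i) (M.right i) v g)

/-- Extension by zero from the patch of the `i`-th vertex. -/
def zeroExt (i : ℕ) (v : ℝ → ℝ) : ℝ → ℝ := (Ioo (M.left i) (M.right i)).indicator v

/-- The quotients `⟨R(u_h), v⟩ / ‖β ∇v‖_{ω_a}` for nonzero `v` in the patchwise space, where the
residual on `Ω` is applied to the extension of `v` by zero. -/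
def localQuotients (β : ℝ) (f u : ℝ → ℝ) (i : ℕ) : Set ℝ :=
  {t | ∃ v g : ℝ → ℝ, M.MemPatchSpace β i v g ∧
    ¬ v =ᵐ[volume.restrict (Ioo (M.left i) (M.right i))] 0 ∧
    t = residual β l r f u (M.zeroExt i v) (M.zeroExt i g) /
      l2norm (M.left i) (M.right i) (fun x => β * g x)}

/-- The dual norm of the residual on the patchwise space. -/
def localDualNorm (β : ℝ) (f u : ℝ → ℝ) (i : ℕ) : ℝ := sSup (M.localQuotients β f u i)

/-- `C > 0` is a Poincaré–Friedrichs constant of the patch `ω_a` of the `i`-th vertex `a`, with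
`h` the diameter of `ω_a`: the Poincaré inequality `‖v - v̄‖ ≤ h C ‖∇v‖` on `H¹(ω_a)` if `a` is not
on the outflow boundary of `Ω`, and the Friedrichs inequality `‖v‖ ≤ h C ‖∇v‖` on `H¹₊(ω_a)`
if it is. -/
def IsPFConst (β : ℝ) (i : ℕ) (C : ℝ) : Prop :=
  0 < C ∧
  (M.x i ∉ outflow β l r → ∀ v g : ℝ → ℝ, MemH1 (M.left i) (M.right i) v g →
    l2norm (M.left i) (M.right i) (fun x => v x - mean (M.left i) (M.right i) v) ≤
      (M.right i - M.left i) * C * l2norm (M.left i) (M.right i) g) ∧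
  (M.x i ∈ outflow β l r → ∀ v g : ℝ → ℝ, MemH1plus β (M.left i) (M.right i) v g →
    l2norm (M.left i) (M.right i) v ≤
      (M.right i - M.left i) * C * l2norm (M.left i) (M.right i) g)

/-- The Poincaré–Friedrichs constant of the patch: the best one. -/
def cPF (β : ℝ) (i : ℕ) : ℝ := sInf {C | M.IsPFConst β i C}

/-- `C_{cont,PF} = max_a (1 + C_{PF,ω_a} h_{ω_a} ‖∇ψ_a‖_∞)`. -/
def cContPF (β : ℝ) : ℝ :=
  (Finset.range (M.n + 1)).sup' Finset.nonempty_range_add_one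
    (fun i => 1 + M.cPF β i * (M.right i - M.left i) * M.hatGradSup i)

/-- Orthogonality of the residual to the hat functions of all interior and inflow vertices. -/
def HatOrthogonal (β : ℝ) (f u : ℝ → ℝ) : Prop :=
  ∀ i ∈ Finset.range (M.n + 1), (M.x i ∈ Ioo l r ∨ M.x i ∈ inflow β l r) →
    residual β l r f u (M.hat i) (deriv (M.hat i)) = 0

end Mesh

end Advection

end

/-! In one dimension an `H¹` function has an absolutely continuous representative, obtained from the
du Bois-Reymond lemma (`MemH1.exists_hasACDeriv`). Traces, zero extensions, products with hat
functions and Poincaré–Friedrichs bounds are all handled on that representative. The factors 2 come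
from the overlap: a point lies in at most two patches (`card_patches_le_two`).

For (a), the hat functions sum to one, so the residual at `v` is the sum of its values at `ψ_a v`.
If `a` is not an outflow vertex, orthogonality allows replacing `v` by `v - v̄` on the patch; at the
outflow vertex `v` itself vanishes. Either way the cut-off function lies in `Y_a`, and the product
rule with the Poincaré–Friedrichs inequality bounds its gradient by `C_cont,PF` times that of `v` on
the patch (`residual_hat_mul_le`). Cauchy–Schwarz over the vertices and the overlap count finish.

For (b), no Riesz representative is needed. Given any `v_a ∈ Y_a`, scale it by residual over squared
norm and add the zero extensions. The residual of the sum is `S`, the sum of the squared local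
quotients, while its squared norm is at most `2S`. Hence `S² ≤ 2 G² S`, with `G` the global dual
norm, so `S ≤ 2 G²` (`sum_sq_quotients_le`); maximizing sequences give the suprema. -/

namespace Advection

/-! ### The scalar product and norm of L² on an interval -/

section L2

variable {l r : ℝ} {v w z : ℝ → ℝ}

/-- Bridge to the Hilbert space `Lp`, from which Cauchy–Schwarz and the triangle inequality are
inherited. -/
lemma ip_eq_inner (hv : MemL2 l r v) (hw : MemL2 l r w) :
    ip l r v w = inner ℝ (hw.toLp w) (hv.toLp v) := by
  rw [L2.inner_def]
  refine integral_congr_ae ?_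
  filter_upwards [hv.coeFn_toLp, hw.coeFn_toLp] with x h1 h2
  simp [h1, h2]

lemma l2norm_eq_norm (hv : MemL2 l r v) : l2norm l r v = ‖hv.toLp v‖ := by
  rw [l2norm, ip_eq_inner hv hv, real_inner_self_eq_norm_sq, Real.sqrt_sq (norm_nonneg _)]

lemma l2norm_nonneg (l r : ℝ) (v : ℝ → ℝ) : 0 ≤ l2norm l r v := Real.sqrt_nonneg _

lemma ip_self_nonneg (l r : ℝ) (v : ℝ → ℝ) : 0 ≤ ip l r v v :=
  integral_nonneg fun x => mul_self_nonneg (v x)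

lemma l2norm_sq (l r : ℝ) (v : ℝ → ℝ) : l2norm l r v ^ 2 = ip l r v v :=
  Real.sq_sqrt (ip_self_nonneg l r v)

lemma ip_comm (l r : ℝ) (v w : ℝ → ℝ) : ip l r v w = ip l r w v := by
  simp only [ip, mul_comm]

lemma ip_congr {v' w' : ℝ → ℝ} (hv : v =ᵐ[volume.restrict (Ioo l r)] v')
    (hw : w =ᵐ[volume.restrict (Ioo l r)] w') : ip l r v w = ip l r v' w' := by
  refine integral_congr_ae ?_
  filter_upwards [hv, hw] with x h1 h2
  rw [h1, h2]

lemma l2norm_congr (h : v =ᵐ[volume.restrict (Ioo l r)] w) : l2norm l r v = l2norm l r w := by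
  rw [l2norm, l2norm, ip_congr h h]

lemma abs_ip_le (hv : MemL2 l r v) (hw : MemL2 l r w) :
    |ip l r v w| ≤ l2norm l r v * l2norm l r w := by
  rw [ip_eq_inner hv hw, l2norm_eq_norm hv, l2norm_eq_norm hw, mul_comm]
  exact abs_real_inner_le_norm _ _

lemma MemL2.integrable_mul (hv : MemL2 l r v) (hw : MemL2 l r w) :
    IntegrableOn (fun x => v x * w x) (Ioo l r) :=
  MemLp.integrable_mul hv hw

lemma MemL2.integrableOn (hv : MemL2 l r v) : IntegrableOn v (Ioo l r) :=
  MemLp.integrable (by norm_num) hv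

lemma MemL2.intervalIntegrable (hlr : l ≤ r) (hv : MemL2 l r v) :
    IntervalIntegrable v volume l r := by
  rw [intervalIntegrable_iff_integrableOn_Ioo_of_le hlr]
  exact hv.integrableOn

lemma memL2_const (c : ℝ) : MemL2 l r (fun _ => c) := memLp_const c

lemma ip_add_right (hv : MemL2 l r v) (hw : MemL2 l r w) (hz : MemL2 l r z) :
    ip l r v (fun x => w x + z x) = ip l r v w + ip l r v z := by
  simp only [ip, mul_add]
  exact integral_add (hv.integrable_mul hw) (hv.integrable_mul hz)

lemma ip_const_mul_right (c : ℝ) : ip l r v (fun x => c * w x) = c * ip l r v w := by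
  simp only [ip, ← integral_const_mul]
  congr 1; ext x; ring

lemma ip_sum_right {ι : Type*} (s : Finset ι) (q : ι → ℝ → ℝ) (hv : MemL2 l r v)
    (hq : ∀ i ∈ s, MemL2 l r (q i)) :
    ip l r v (fun x => ∑ i ∈ s, q i x) = ∑ i ∈ s, ip l r v (q i) := by
  simp only [ip, Finset.mul_sum]
  exact integral_finsetSum s fun i hi => hv.integrable_mul (hq i hi)

lemma MemL2.add (hv : MemL2 l r v) (hw : MemL2 l r w) : MemL2 l r (fun x => v x + w x) :=
  MemLp.add hv hw

lemma MemL2.sub (hv : MemL2 l r v) (hw : MemL2 l r w) : MemL2 l r (fun x => v x - w x) :=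
  MemLp.sub hv hw

lemma MemL2.const_mul (c : ℝ) (hv : MemL2 l r v) : MemL2 l r (fun x => c * v x) :=
  MemLp.const_mul hv c

lemma MemL2.sum {ι : Type*} (s : Finset ι) {q : ι → ℝ → ℝ}
    (hq : ∀ i ∈ s, MemL2 l r (q i)) : MemL2 l r (fun x => ∑ i ∈ s, q i x) :=
  memLp_finsetSum s hq

lemma MemL2.congr (hv : MemL2 l r v) (h : v =ᵐ[volume.restrict (Ioo l r)] w) : MemL2 l r w :=
  (memLp_congr_ae h).1 hv

lemma MemL2.mono {L R : ℝ} (hL : l ≤ L) (hR : R ≤ r) (hv : MemL2 l r v) : MemL2 L R v :=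
  MemLp.mono_measure (Measure.restrict_mono (Ioo_subset_Ioo hL hR) le_rfl) hv

lemma _root_.ContinuousOn.memL2 (hv : ContinuousOn v (Icc l r)) : MemL2 l r v := by
  obtain ⟨C, hC⟩ := isCompact_Icc.exists_bound_of_continuousOn hv
  refine MemLp.of_bound
    ((hv.mono Ioo_subset_Icc_self).aestronglyMeasurable measurableSet_Ioo) C ?_
  filter_upwards [ae_restrict_mem measurableSet_Ioo] with x hx
  exact hC x (Ioo_subset_Icc_self hx)

lemma MemL2.mul_of_bound {C : ℝ} (hv : MemL2 l r v)
    (hw : AEStronglyMeasurable w (volume.restrict (Ioo l r)))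
    (hC : ∀ᵐ x ∂volume.restrict (Ioo l r), |w x| ≤ C) : MemL2 l r (fun x => w x * v x) := by
  refine MemLp.of_le_mul hv (hw.mul hv.1) (c := C) ?_
  filter_upwards [hC] with x hx
  rw [norm_mul]
  exact mul_le_mul_of_nonneg_right hx (norm_nonneg _)

lemma l2norm_add_le (hv : MemL2 l r v) (hw : MemL2 l r w) :
    l2norm l r (fun x => v x + w x) ≤ l2norm l r v + l2norm l r w := by
  rw [l2norm_eq_norm hv, l2norm_eq_norm hw, l2norm_eq_norm (hv.add hw)]
  exact norm_add_le (hv.toLp v) (hw.toLp w)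

lemma l2norm_const_mul (c : ℝ) : l2norm l r (fun x => c * v x) = |c| * l2norm l r v := by
  rw [l2norm, l2norm, ip_const_mul_right, ip_comm, ip_const_mul_right, ← mul_assoc,
    Real.sqrt_mul (mul_self_nonneg c), Real.sqrt_mul_self_eq_abs]

lemma l2norm_le_of_ae_abs_le (hw : MemL2 l r w)
    (h : ∀ᵐ x ∂volume.restrict (Ioo l r), |v x| ≤ |w x|) : l2norm l r v ≤ l2norm l r w := by
  refine Real.sqrt_le_sqrt (integral_mono_of_nonneg ?_ (hw.integrable_mul hw) ?_)
  · exact Filter.Eventually.of_forall fun x => mul_self_nonneg (v x)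
  · filter_upwards [h] with x hx
    exact abs_le_iff_mul_self_le.1 hx

lemma l2norm_le_of_ae_abs_le_mul {K : ℝ} (hK : 0 ≤ K) (hw : MemL2 l r w)
    (h : ∀ᵐ x ∂volume.restrict (Ioo l r), |v x| ≤ K * |w x|) :
    l2norm l r v ≤ K * l2norm l r w := by
  rw [← abs_of_nonneg hK, ← l2norm_const_mul]
  refine l2norm_le_of_ae_abs_le (hw.const_mul K) ?_
  filter_upwards [h] with x hx
  rwa [abs_mul, abs_of_nonneg hK]

lemma l2norm_one (hlr : l ≤ r) : l2norm l r (fun _ => 1) = √(r - l) := by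
  simp [l2norm, ip, hlr]

lemma ae_eq_zero_of_l2norm_eq_zero (hv : MemL2 l r v) (h : l2norm l r v = 0) :
    v =ᵐ[volume.restrict (Ioo l r)] 0 := by
  rw [l2norm_eq_norm hv, norm_eq_zero] at h
  filter_upwards [hv.coeFn_toLp, Lp.coeFn_zero ℝ 2 (volume.restrict (Ioo l r))] with x h1 h2
  rw [← h1, h, h2]

lemma ip_indicator_right {L R : ℝ} (hL : l ≤ L) (hR : R ≤ r) :
    ip l r v ((Ioo L R).indicator w) = ip L R v w := by
  have : ∀ x, v x * (Ioo L R).indicator w x = (Ioo L R).indicator (fun x => v x * w x) x := by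
    intro x; by_cases hx : x ∈ Ioo L R <;> simp [hx]
  simp only [ip, this]
  rw [setIntegral_indicator measurableSet_Ioo,
    inter_eq_self_of_subset_right (Ioo_subset_Ioo hL hR)]

lemma l2norm_indicator {L R : ℝ} (hL : l ≤ L) (hR : R ≤ r) :
    l2norm l r ((Ioo L R).indicator v) = l2norm L R v := by
  rw [l2norm, l2norm, ip_indicator_right hL hR]
  congr 1
  refine setIntegral_congr_fun measurableSet_Ioo fun x hx => ?_
  simp [indicator_of_mem hx]

lemma MemL2.indicator {L R : ℝ} (hL : l ≤ L) (hR : R ≤ r) (hv : MemL2 L R v) :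
    MemL2 l r ((Ioo L R).indicator v) := by
  rw [MemL2, memLp_indicator_iff_restrict measurableSet_Ioo, Measure.restrict_restrict
    measurableSet_Ioo, inter_eq_self_of_subset_left (Ioo_subset_Ioo hL hR)]
  exact hv

end L2

/-! ### Absolutely continuous functions and their weak derivatives -/

lemma intervalIntegral_eq_setIntegral_Ioo {l r : ℝ} (hlr : l ≤ r) (v : ℝ → ℝ) :
    ∫ x in l..r, v x = ∫ x in Ioo l r, v x := by
  rw [intervalIntegral.integral_of_le hlr, integral_Ioc_eq_integral_Ioo]

/-- `w` is absolutely continuous on `[l, r]` with derivative `g` almost everywhere. -/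
def HasACDeriv (l r : ℝ) (w g : ℝ → ℝ) : Prop :=
  AbsolutelyContinuousOnInterval w l r ∧ ∀ᵐ x ∂volume.restrict (Ioo l r), HasDerivAt w (g x) x

section AC

variable {l r : ℝ} {v w g w₁ w₂ g₁ g₂ : ℝ → ℝ}

lemma HasACDeriv.continuousOn (hlr : l ≤ r) (h : HasACDeriv l r w g) :
    ContinuousOn w (Icc l r) := by
  simpa [uIcc_of_le hlr] using h.1.continuousOn

lemma HasACDeriv.ae_eq_deriv (h : HasACDeriv l r w g) :
    g =ᵐ[volume.restrict (Ioo l r)] deriv w := by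
  filter_upwards [h.2] with x hx using hx.deriv.symm

lemma _root_.AbsolutelyContinuousOnInterval.hasACDeriv (hlr : l ≤ r)
    (h : AbsolutelyContinuousOnInterval w l r) : HasACDeriv l r w (deriv w) := by
  refine ⟨h, ?_⟩
  filter_upwards [ae_restrict_mem measurableSet_Ioo,
    ae_restrict_of_ae h.ae_differentiableAt] with x hx hd
  exact (hd (by rw [uIcc_of_le hlr]; exact Ioo_subset_Icc_self hx)).hasDerivAt

lemma HasACDeriv.congr_deriv (h : HasACDeriv l r w g₁)
    (hg : g₁ =ᵐ[volume.restrict (Ioo l r)] g₂) : HasACDeriv l r w g₂ := by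
  refine ⟨h.1, ?_⟩
  filter_upwards [h.2, hg] with x hx hgx
  rwa [← hgx]

lemma HasACDeriv.mono {L R : ℝ} (hL : l ≤ L) (hLR : L ≤ R) (hR : R ≤ r)
    (h : HasACDeriv l r w g) : HasACDeriv L R w g := by
  refine ⟨h.1.mono ?_, ae_restrict_of_ae_restrict_of_subset (Ioo_subset_Ioo hL hR) h.2⟩
  rw [uIcc_of_le hLR, uIcc_of_le (hL.trans (hLR.trans hR))]
  exact Icc_subset_Icc hL hR

lemma HasACDeriv.mul (h₁ : HasACDeriv l r w₁ g₁) (h₂ : HasACDeriv l r w₂ g₂) :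
    HasACDeriv l r (fun x => w₁ x * w₂ x) (fun x => g₁ x * w₂ x + w₁ x * g₂ x) := by
  refine ⟨h₁.1.mul h₂.1, ?_⟩
  filter_upwards [h₁.2, h₂.2] with x hx₁ hx₂ using hx₁.mul hx₂

lemma HasACDeriv.add_const (h : HasACDeriv l r w g) (c : ℝ) :
    HasACDeriv l r (fun x => w x + c) g := by
  refine ⟨?_, ?_⟩
  · have hc : AbsolutelyContinuousOnInterval (fun _ : ℝ => c) l r :=
      ((LipschitzWith.const c).lipschitzOnWith).absolutelyContinuousOnInterval
    exact h.1.add hc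
  · filter_upwards [h.2] with x hx using hx.add_const c

lemma HasACDeriv.intervalIntegrable (hlr : l ≤ r) (h : HasACDeriv l r w g) :
    IntervalIntegrable g volume l r := by
  have := h.1.intervalIntegrable_deriv
  rw [intervalIntegrable_iff_integrableOn_Ioo_of_le hlr] at this ⊢
  exact this.congr_fun_ae h.ae_eq_deriv.symm

lemma HasACDeriv.integral_eq_sub (hlr : l ≤ r) (h : HasACDeriv l r w g) :
    ∫ x in Ioo l r, g x = w r - w l := by
  rw [← h.1.integral_deriv_eq_sub, intervalIntegral_eq_setIntegral_Ioo hlr]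
  exact integral_congr_ae h.ae_eq_deriv

lemma hasACDeriv_integral (hlr : l ≤ r) (hg : IntervalIntegrable g volume l r) :
    HasACDeriv l r (fun x => ∫ t in l..x, g t) g := by
  refine ⟨hg.absolutelyContinuousOnInterval_intervalIntegral left_mem_uIcc, ?_⟩
  filter_upwards [ae_restrict_mem measurableSet_Ioo,
    ae_restrict_of_ae hg.ae_hasDerivAt_integral] with x hx hd
  exact hd (by rw [uIcc_of_le hlr]; exact Ioo_subset_Icc_self hx) l left_mem_uIcc

lemma HasACDeriv.eq_add_integral (h : HasACDeriv l r w g) {x : ℝ} (hx : x ∈ Icc l r) :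
    w x = w l + ∫ t in l..x, g t := by
  rw [intervalIntegral_eq_setIntegral_Ioo hx.1,
    (h.mono le_rfl hx.1 hx.2).integral_eq_sub hx.1]
  ring

/-- Integration by parts; a test function supported in the open interval vanishes at both ends. -/
lemma HasACDeriv.isWeakDeriv (hlr : l ≤ r) (h : HasACDeriv l r w g) : IsWeakDeriv l r w g := by
  intro φ hφ hφc hφs
  have hφac : AbsolutelyContinuousOnInterval φ l r :=
    ContDiffOn.absolutelyContinuousOnInterval (hφ.of_le (by simp)).contDiffOn
  have hl : φ l = 0 := image_eq_zero_of_notMem_tsupport fun hm => lt_irrefl l (hφs hm).1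
  have hr : φ r = 0 := image_eq_zero_of_notMem_tsupport fun hm => lt_irrefl r (hφs hm).2
  have := h.1.integral_mul_deriv_eq_deriv_mul hφac
  rw [hl, hr, intervalIntegral_eq_setIntegral_Ioo hlr,
    intervalIntegral_eq_setIntegral_Ioo hlr] at this
  rw [ip, this, ip]
  simp only [mul_zero, sub_zero, zero_sub, neg_inj]
  refine integral_congr_ae ?_
  filter_upwards [h.ae_eq_deriv] with x hx
  rw [hx]

lemma IsWeakDeriv.congr_left (h : IsWeakDeriv l r v g)
    (hvw : v =ᵐ[volume.restrict (Ioo l r)] w) : IsWeakDeriv l r w g := by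
  intro φ h₁ h₂ h₃
  rw [← h φ h₁ h₂ h₃]
  exact ip_congr hvw.symm (ae_eq_refl _)

lemma HasACDeriv.memH1 (hlr : l ≤ r) (h : HasACDeriv l r w g) (hg : MemL2 l r g)
    (hvw : v =ᵐ[volume.restrict (Ioo l r)] w) : MemH1 l r v g :=
  ⟨(h.continuousOn hlr).memL2.congr hvw.symm, hg, (h.isWeakDeriv hlr).congr_left hvw.symm⟩

/-! ### The du Bois-Reymond lemma and continuous representatives -/

lemma exists_Icc_superset_of_isCompact {K : Set ℝ} (hlr : l < r) (hK : IsCompact K)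
    (hKs : K ⊆ Ioo l r) : ∃ a b, l < a ∧ b < r ∧ K ⊆ Icc a b := by
  rcases K.eq_empty_or_nonempty with rfl | hne
  -- The reversed pair is deliberate: both strict bounds then reduce to `l < r`.
  · exact ⟨r, l, hlr, hlr, empty_subset _⟩
  · obtain ⟨a, ha, ha'⟩ := hK.exists_isLeast hne
    obtain ⟨b, hb, hb'⟩ := hK.exists_isGreatest hne
    exact ⟨a, b, (hKs ha).1, (hKs hb).2, fun x hx => ⟨ha' hx, hb' hx⟩⟩

/-- A test function with zero mean is the derivative of a test function. -/
lemma exists_deriv_eq_of_integral_eq_zero (hlr : l < r) {χ : ℝ → ℝ} (hχ : ContDiff ℝ ∞ χ)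
    (hc : HasCompactSupport χ) (hs : tsupport χ ⊆ Ioo l r) (h0 : ∫ x in Ioo l r, χ x = 0) :
    ∃ φ : ℝ → ℝ, ContDiff ℝ ∞ φ ∧ HasCompactSupport φ ∧ tsupport φ ⊆ Ioo l r ∧ deriv φ = χ := by
  obtain ⟨a, b, hla, hbr, hab⟩ := exists_Icc_superset_of_isCompact hlr hc hs
  have hz : ∀ x, x ∉ Icc a b → χ x = 0 := fun x hx =>
    image_eq_zero_of_notMem_tsupport fun hm => hx (hab hm)
  have hcont := hχ.continuous
  have hder : ∀ x, HasDerivAt (fun x => ∫ t in l..x, χ t) (χ x) x := fun x =>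
    intervalIntegral.integral_hasDerivAt_right (hcont.intervalIntegrable _ _)
      (hcont.stronglyMeasurableAtFilter _ _) hcont.continuousAt
  have hd : deriv (fun x => ∫ t in l..x, χ t) = χ := funext fun x => (hder x).deriv
  have hsupp : Function.support (fun x => ∫ t in l..x, χ t) ⊆ Icc a b := by
    intro x hx
    by_contra hxab
    refine hx ?_
    rw [mem_Icc, not_and_or, not_le, not_le] at hxab
    rcases hxab with hxa | hbx
    · refine (intervalIntegral.integral_congr fun t ht => ?_).trans
        intervalIntegral.integral_zero
      refine hz t fun hm => ?_
      exact absurd (ht.2.trans_lt (max_lt hla hxa)) (not_lt.2 hm.1)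
    -- Only here is the zero mean used: to the right of the support the primitive equals the total
    -- integral.
    · have h1 : ∫ t in l..r, χ t = 0 := by
        rw [intervalIntegral_eq_setIntegral_Ioo hlr.le, h0]
      have h2 : ∫ t in x..r, χ t = 0 := by
        refine (intervalIntegral.integral_congr fun t ht => ?_).trans
          intervalIntegral.integral_zero
        refine hz t fun hm => ?_
        exact absurd ((lt_min hbx hbr).trans_le ht.1) (not_lt.2 hm.2)
      have h3 := intervalIntegral.integral_add_adjacent_intervals
        (hcont.intervalIntegrable (μ := volume) l x) (hcont.intervalIntegrable x r)
      simpa [h1, h2] using h3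
  have hts : tsupport (fun x => ∫ t in l..x, χ t) ⊆ Icc a b :=
    closure_minimal hsupp isClosed_Icc
  refine ⟨_, ?_, HasCompactSupport.of_support_subset_isCompact isCompact_Icc hsupp,
    hts.trans (Icc_subset_Ioo hla hbr), hd⟩
  rw [contDiff_infty_iff_deriv, hd]
  exact ⟨fun x => (hder x).differentiableAt, hχ⟩

/-- The du Bois-Reymond lemma. -/
lemma ae_eq_const_of_isWeakDeriv_zero (hlr : l < r) (hw : IntegrableOn w (Ioo l r))
    (h : ∀ φ : ℝ → ℝ, ContDiff ℝ ∞ φ → HasCompactSupport φ → tsupport φ ⊆ Ioo l r →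
      ip l r w (deriv φ) = 0) :
    ∃ c : ℝ, w =ᵐ[volume.restrict (Ioo l r)] fun _ => c := by
  let B : ContDiffBump ((l + r) / 2) :=
    { rIn := (r - l) / 8, rOut := (r - l) / 4, rIn_pos := by linarith, rIn_lt_rOut := by linarith }
  set η : ℝ → ℝ := B.normed volume with hη
  have hηs : tsupport η ⊆ Ioo l r := by
    rw [hη, B.tsupport_normed_eq, Real.closedBall_eq_Icc]
    refine Icc_subset_Ioo ?_ ?_
    · change l < (l + r) / 2 - (r - l) / 4
      linarith
    · change (l + r) / 2 + (r - l) / 4 < r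
      linarith
  have hηd : ContDiff ℝ ∞ η := B.contDiff_normed
  have hηc : HasCompactSupport η := B.hasCompactSupport_normed
  have hη1 : ∫ x in Ioo l r, η x = 1 := by
    rw [setIntegral_eq_integral_of_forall_compl_eq_zero, hη, B.integral_normed]
    exact fun x hx => image_eq_zero_of_notMem_tsupport fun hm => hx (hηs hm)
  have hint : ∀ χ : ℝ → ℝ, Continuous χ → IntegrableOn (fun x => w x * χ x) (Ioo l r) := by
    intro χ hχ
    exact ((hw.congr_set_ae Ioo_ae_eq_Icc.symm).mul_continuousOn hχ.continuousOn
      isCompact_Icc).mono_set Ioo_subset_Icc_self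
  have hintχ : ∀ χ : ℝ → ℝ, Continuous χ → IntegrableOn χ (Ioo l r) := fun χ hχ =>
    (hχ.continuousOn.integrableOn_compact isCompact_Icc).mono_set Ioo_subset_Icc_self
  -- Subtracting `(∫ χ) η` from `χ` leaves a test function of mean zero, hence a derivative. So `w`
  -- acts on `χ` as the constant `ip l r w η` does.
  have key : ∀ χ : ℝ → ℝ, ContDiff ℝ ∞ χ → HasCompactSupport χ → tsupport χ ⊆ Ioo l r →
      ip l r w χ = (∫ x in Ioo l r, χ x) * ip l r w η := by
    intro χ hχ hχc hχs
    obtain ⟨φ, h1, h2, h3, h4⟩ := exists_deriv_eq_of_integral_eq_zero hlr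
      (χ := χ - (∫ x in Ioo l r, χ x) • η) (hχ.sub (contDiff_const.smul hηd))
      (hχc.sub (hηc.smul_left (f := fun _ => ∫ x in Ioo l r, χ x)))
      ((tsupport_sub _ _).trans (union_subset hχs
        ((tsupport_smul_subset_right (fun _ => ∫ x in Ioo l r, χ x) η).trans hηs)))
      (by
        simp only [Pi.sub_apply, Pi.smul_apply, smul_eq_mul]
        rw [integral_sub (hintχ χ hχ.continuous) ((hintχ η hηd.continuous).const_mul _),
          integral_const_mul, hη1, mul_one, sub_self])
    have h5 := h φ h1 h2 h3
    rw [h4, ip] at h5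
    have h6 : ∀ x, w x * (χ - (∫ x in Ioo l r, χ x) • η) x
        = w x * χ x - (∫ x in Ioo l r, χ x) * (w x * η x) := by
      intro x
      simp only [Pi.sub_apply, Pi.smul_apply, smul_eq_mul]
      ring
    simp only [h6] at h5
    rw [integral_sub (hint χ hχ.continuous) ((hint η hηd.continuous).const_mul _),
      integral_const_mul, sub_eq_zero] at h5
    exact h5
  refine ⟨ip l r w η, ?_⟩
  have hzero := isOpen_Ioo.ae_eq_zero_of_integral_contDiff_smul_eq_zero (U := Ioo l r)
    (μ := volume) (f := fun x => w x - ip l r w η)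
    ((hw.sub (integrableOn_const (by simp))).locallyIntegrableOn) ?_
  · rw [Filter.EventuallyEq, ae_restrict_iff' measurableSet_Ioo]
    filter_upwards [hzero] with x hx hxm using sub_eq_zero.1 (hx hxm)
  · intro χ hχ hχc hχs
    rw [← setIntegral_eq_integral_of_forall_compl_eq_zero (s := Ioo l r)
      (fun x hx => by rw [image_eq_zero_of_notMem_tsupport fun hm => hx (hχs hm), zero_smul])]
    have h6 : ∀ x, χ x • (w x - ip l r w η) = w x * χ x - ip l r w η * χ x := by
      intro x
      rw [smul_eq_mul]
      ring
    simp only [h6]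
    rw [integral_sub (hint χ hχ.continuous) ((hintχ χ hχ.continuous).const_mul _),
      integral_const_mul, sub_eq_zero, mul_comm]
    exact key χ hχ hχc hχs

/-- Functions in `H¹(l, r)` have an absolutely continuous representative. -/
lemma MemH1.exists_hasACDeriv (hlr : l < r) (h : MemH1 l r v g) :
    ∃ w, HasACDeriv l r w g ∧ v =ᵐ[volume.restrict (Ioo l r)] w := by
  obtain ⟨hv, hg, hvg⟩ := h
  have hG := hasACDeriv_integral hlr.le (hg.intervalIntegrable hlr.le)
  have hGv := hG.isWeakDeriv hlr.le
  have hGi : MemL2 l r (fun x => ∫ t in l..x, g t) := (hG.continuousOn hlr.le).memL2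
  -- `v` and the primitive of `g` have the same weak derivative, so they differ by a constant.
  obtain ⟨c, hc⟩ := ae_eq_const_of_isWeakDeriv_zero hlr (hv.sub hGi).integrableOn
    (fun φ h1 h2 h3 => by
      have hφ : MemL2 l r (deriv φ) :=
        (h1.continuous_deriv (by simp)).continuousOn.memL2
      have e : ip l r (fun x => v x - ∫ t in l..x, g t) (deriv φ)
          = ip l r v (deriv φ) - ip l r (fun x => ∫ t in l..x, g t) (deriv φ) := by
        simp only [ip, sub_mul]
        exact integral_sub (hv.integrable_mul hφ) (hGi.integrable_mul hφ)
      rw [e, hvg φ h1 h2 h3, hGv φ h1 h2 h3, sub_self])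
  refine ⟨_, hG.add_const c, ?_⟩
  filter_upwards [hc] with x hx
  linarith

lemma eqOn_Icc_of_ae_eq_Ioo (hlr : l < r) (hv : ContinuousOn v (Icc l r))
    (hw : ContinuousOn w (Icc l r)) (h : v =ᵐ[volume.restrict (Ioo l r)] w) :
    EqOn v w (Icc l r) := by
  refine Measure.eqOn_Icc_of_ae_eq (μ := volume) hlr.ne ?_ hv hw
  rwa [Measure.restrict_congr_set Ioo_ae_eq_Icc] at h

/-- Continuous representatives agree up to the endpoints, so the existential trace condition
transfers to whichever representative is at hand. -/
lemma ZeroTrace.eq_zero {c : ℝ} (hlr : l < r) (h : ZeroTrace l r v c)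
    (hw : ContinuousOn w (Icc l r)) (hvw : v =ᵐ[volume.restrict (Ioo l r)] w)
    (hc : c ∈ Icc l r) : w c = 0 := by
  obtain ⟨z, hz, hvz, hzc⟩ := h
  rw [eqOn_Icc_of_ae_eq_Ioo hlr hw hz (hvw.symm.trans hvz) hc, hzc]

/-- Extension by zero of functions that vanish at the interior endpoints. -/
lemma HasACDeriv.exists_indicator {L R : ℝ} (hL : l ≤ L) (hLR : L < R) (hR : R ≤ r)
    (hw : HasACDeriv L R w g) (h₁ : L = l ∨ w L = 0) (h₂ : R = r ∨ w R = 0) :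
    ∃ z, HasACDeriv l r z ((Ioo L R).indicator g) ∧ EqOn z ((Ioo L R).indicator w) (Ioo l r) ∧
      (w L = 0 → z l = 0) ∧ (w R = 0 → z r = 0) := by
  have hlr : l ≤ r := hL.trans (hLR.le.trans hR)
  have hg := hw.intervalIntegrable hLR.le
  rw [intervalIntegrable_iff_integrableOn_Ioo_of_le hLR.le] at hg
  have hgi : Integrable ((Ioo L R).indicator g) :=
    (integrable_indicator_iff measurableSet_Ioo).2 hg
  -- The extension is the primitive of the extended derivative, started at `w L`: it is `w L` before
  -- `L`, then `w`, then `w R` after `R`. The outer constants are zero wherever the outer pieces are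
  -- nonempty.
  have hz := (hasACDeriv_integral hlr
    (hgi.intervalIntegrable (a := l) (b := r))).add_const (w L)
  have e1 : ∀ x, l ≤ x → x ≤ L → ∫ t in l..x, (Ioo L R).indicator g t = 0 := by
    intro x hlx hx
    refine (intervalIntegral.integral_congr fun t ht => ?_).trans intervalIntegral.integral_zero
    rw [uIcc_of_le hlx] at ht
    exact indicator_of_notMem (fun hm : t ∈ Ioo L R => absurd (ht.2.trans hx) (not_le.2 hm.1)) _
  have e2 : ∀ x, L ≤ x → x ≤ R → ∫ t in l..x, (Ioo L R).indicator g t = w x - w L := by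
    intro x hLx hx
    rw [← intervalIntegral.integral_add_adjacent_intervals (b := L)
      hgi.intervalIntegrable hgi.intervalIntegrable, e1 L hL le_rfl, zero_add,
      hw.eq_add_integral ⟨hLx, hx⟩, add_sub_cancel_left,
      intervalIntegral_eq_setIntegral_Ioo hLx, intervalIntegral_eq_setIntegral_Ioo hLx]
    refine setIntegral_congr_fun measurableSet_Ioo fun t ht => ?_
    exact indicator_of_mem (show t ∈ Ioo L R from ⟨ht.1, ht.2.trans_le hx⟩) _
  have e3 : ∀ x, R ≤ x → ∫ t in l..x, (Ioo L R).indicator g t = w R - w L := by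
    intro x hRx
    rw [← intervalIntegral.integral_add_adjacent_intervals (b := R)
      hgi.intervalIntegrable hgi.intervalIntegrable, e2 R hLR.le le_rfl, add_eq_left]
    refine (intervalIntegral.integral_congr fun t ht => ?_).trans intervalIntegral.integral_zero
    rw [uIcc_of_le hRx] at ht
    exact indicator_of_notMem (fun hm : t ∈ Ioo L R => absurd ht.1 (not_le.2 hm.2)) _
  refine ⟨_, hz, ?_, ?_, ?_⟩
  · intro x hx
    rcases le_or_gt x L with hxL | hxL
    · rw [indicator_of_notMem (fun hm => absurd hm.1 (not_lt.2 hxL))]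
      rcases h₁ with rfl | h₁
      · exact absurd hx.1 (not_lt.2 hxL)
      · simp only [e1 x hx.1.le hxL, h₁, add_zero]
    rcases le_or_gt R x with hxR | hxR
    · rw [indicator_of_notMem (fun hm => absurd hm.2 (not_lt.2 hxR))]
      rcases h₂ with rfl | h₂
      · exact absurd hx.2 (not_lt.2 hxR)
      · simp only [e3 x hxR, h₂, sub_add_cancel]
    · rw [indicator_of_mem (show x ∈ Ioo L R from ⟨hxL, hxR⟩)]
      simp only [e2 x hxL.le hxR.le, sub_add_cancel]
  · intro h
    simp [h]
  · intro h
    simp only [e3 r hR, h, sub_add_cancel]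

lemma l2norm_mono {L R : ℝ} (hL : l ≤ L) (hR : R ≤ r) (hv : MemL2 l r v) :
    l2norm L R v ≤ l2norm l r v :=
  Real.sqrt_le_sqrt (setIntegral_mono_set (hv.integrable_mul hv)
    (Filter.Eventually.of_forall fun t => mul_self_nonneg (v t))
    (Ioo_subset_Ioo hL hR).eventuallyLE)

/-- The fundamental theorem of calculus, then Cauchy–Schwarz against the constant 1. -/
lemma HasACDeriv.abs_sub_le {x y : ℝ} (h : HasACDeriv l r w g) (hg : MemL2 l r g)
    (hx : x ∈ Icc l r) (hy : y ∈ Icc l r) : |w x - w y| ≤ √(r - l) * l2norm l r g := by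
  wlog hxy : y ≤ x generalizing x y
  · rw [abs_sub_comm]
    exact this hy hx (le_of_not_ge hxy)
  have hg' := hg.mono hy.1 hx.2
  rw [← (h.mono hy.1 hxy hx.2).integral_eq_sub hxy]
  calc |∫ t in Ioo y x, g t| = |ip y x (fun _ => 1) g| := by simp [ip]
    _ ≤ l2norm y x (fun _ => 1) * l2norm y x g := abs_ip_le (memL2_const 1) hg'
    _ ≤ √(r - l) * l2norm l r g := by
      rw [l2norm_one hxy]
      exact mul_le_mul (Real.sqrt_le_sqrt (by linarith [hx.2, hy.1]))
        (l2norm_mono hy.1 hx.2 hg) (l2norm_nonneg _ _ _) (Real.sqrt_nonneg _)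

lemma HasACDeriv.l2norm_sub_le {y : ℝ} (hlr : l ≤ r) (h : HasACDeriv l r w g)
    (hg : MemL2 l r g) (hy : y ∈ Icc l r) :
    l2norm l r (fun x => w x - w y) ≤ (r - l) * l2norm l r g := by
  have := l2norm_le_of_ae_abs_le_mul (v := fun x => w x - w y)
    (mul_nonneg (Real.sqrt_nonneg (r - l)) (l2norm_nonneg l r g))
    (memL2_const (l := l) (r := r) 1) (by
      filter_upwards [ae_restrict_mem measurableSet_Ioo] with x hx
      simpa using h.abs_sub_le hg (Ioo_subset_Icc_self hx) hy)
  rwa [l2norm_one hlr, mul_right_comm, Real.mul_self_sqrt (sub_nonneg.2 hlr)] at this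

end AC

/-! ### Inflow and outflow endpoints according to the sign of β -/

section Boundary

variable {β l r c : ℝ}

lemma mem_outflow_of_pos (hβ : 0 < β) : c ∈ outflow β l r ↔ c = r := by
  simp [outflow, hβ, hβ.le]

lemma mem_outflow_of_neg (hβ : β < 0) : c ∈ outflow β l r ↔ c = l := by
  simp [outflow, hβ, hβ.le]

lemma mem_inflow_of_pos (hβ : 0 < β) : c ∈ inflow β l r ↔ c = l := by
  simp [inflow, hβ, hβ.le]

lemma mem_inflow_of_neg (hβ : β < 0) : c ∈ inflow β l r ↔ c = r := by
  simp [inflow, hβ, hβ.le]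

lemma exists_outflow_eq (hβ : β ≠ 0) (hlr : l ≤ r) :
    ∃ c ∈ Icc l r, ∀ x, x ∈ outflow β l r ↔ x = c := by
  rcases hβ.lt_or_gt with h | h
  · exact ⟨l, left_mem_Icc.2 hlr, fun x => mem_outflow_of_neg h⟩
  · exact ⟨r, right_mem_Icc.2 hlr, fun x => mem_outflow_of_pos h⟩

end Boundary

/-! ### Poincaré and Friedrichs inequalities with constant 1 -/

section PoincareFriedrichs

variable {β l r : ℝ} {v g : ℝ → ℝ}

/-- The mean is the best constant approximation: the two squared norms differ by `(mean - c)² (r -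
l)`. This lets the Poincaré inequality be proved with an endpoint value in place of the mean. -/
lemma l2norm_sub_mean_le (hlr : l < r) (hv : MemL2 l r v) (c : ℝ) :
    l2norm l r (fun x => v x - mean l r v) ≤ l2norm l r (fun x => v x - c) := by
  have key : ∀ d : ℝ, ip l r (fun x => v x - d) (fun x => v x - d)
      = ip l r v v - 2 * d * (mean l r v * (r - l)) + d ^ 2 * (r - l) := by
    intro d
    have hm : mean l r v * (r - l) = ∫ x in Ioo l r, v x := by
      rw [mean, div_mul_cancel₀ _ (sub_pos.2 hlr).ne']
      simp [ip]
    have e : ∀ x, (v x - d) * (v x - d) = v x * v x - 2 * d * v x + d ^ 2 := fun x => by ring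
    simp only [ip, e]
    have h1 : IntegrableOn (fun x => v x * v x) (Ioo l r) := hv.integrable_mul hv
    have h2 : IntegrableOn (fun x => 2 * d * v x) (Ioo l r) := hv.integrableOn.const_mul _
    have h3 : IntegrableOn (fun _ => d ^ 2) (Ioo l r) := integrableOn_const (by simp)
    have h12 : IntegrableOn (fun x => v x * v x - 2 * d * v x) (Ioo l r) := h1.sub h2
    rw [integral_add h12 h3, integral_sub h1 h2, integral_const_mul, hm]
    simp [hlr.le, mul_comm]
  refine Real.sqrt_le_sqrt ?_
  rw [key, key]
  nlinarith [mul_nonneg (sq_nonneg (mean l r v - c)) (sub_pos.2 hlr).le]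

lemma poincare (hlr : l < r) (h : MemH1 l r v g) :
    l2norm l r (fun x => v x - mean l r v) ≤ (r - l) * l2norm l r g := by
  obtain ⟨w, hw, hvw⟩ := h.exists_hasACDeriv hlr
  refine (l2norm_sub_mean_le hlr h.1 (w l)).trans ?_
  rw [l2norm_congr (w := fun x => w x - w l)
    (by filter_upwards [hvw] with x hx; rw [hx])]
  exact hw.l2norm_sub_le hlr.le h.2.1 (left_mem_Icc.2 hlr.le)

lemma friedrichs (hβ : β ≠ 0) (hlr : l < r) (h : MemH1plus β l r v g) :
    l2norm l r v ≤ (r - l) * l2norm l r g := by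
  obtain ⟨w, hw, hvw⟩ := h.1.exists_hasACDeriv hlr
  obtain ⟨c, hc, hout⟩ := exists_outflow_eq hβ hlr.le
  have h0 := (h.2 c ((hout c).2 rfl)).eq_zero hlr (hw.continuousOn hlr.le) hvw hc
  rw [l2norm_congr (w := fun x => w x - w c)
    (by filter_upwards [hvw] with x hx; rw [hx, h0, sub_zero])]
  exact hw.l2norm_sub_le hlr.le h.1.2.1 hc

/-- An affine function with gradient 1, used to keep the Poincaré–Friedrichs constants away from
zero. -/
lemma memH1_sub_const (hlr : l < r) (c : ℝ) : MemH1 l r (fun x => x - c) (fun _ => 1) := by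
  refine HasACDeriv.memH1 hlr.le (w := fun x => x - c) ⟨?_, ?_⟩ (memL2_const 1) (ae_eq_refl _)
  · exact ContDiffOn.absolutelyContinuousOnInterval
      ((contDiff_id.sub contDiff_const).contDiffOn)
  · exact Filter.Eventually.of_forall fun x => (hasDerivAt_id x).sub_const c

lemma l2norm_sub_const_pos (hlr : l < r) (c : ℝ) : 0 < l2norm l r (fun x => x - c) := by
  refine (l2norm_nonneg _ _ _).lt_of_ne fun h => ?_
  have h0 := ae_eq_zero_of_l2norm_eq_zero (memH1_sub_const hlr c).1 h.symm
  have h1 := eqOn_Icc_of_ae_eq_Ioo hlr (by fun_prop) continuousOn_const h0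
  have hl := h1 (left_mem_Icc.2 hlr.le)
  have hr := h1 (right_mem_Icc.2 hlr.le)
  simp only at hl hr
  linarith

end PoincareFriedrichs

/-! ### Mesh geometry and the best Poincaré–Friedrichs constant -/

namespace Mesh

variable {β l r : ℝ} (M : Mesh l r) {i : ℕ}

lemma n_pos (hlr : l < r) : 0 < M.n := by
  rcases Nat.eq_zero_or_pos M.n with h | h
  · have h1 := M.x_last
    rw [h, M.x_zero] at h1
    exact absurd h1 hlr.ne
  · exact h

lemma x_le {i j : ℕ} (hij : i ≤ j) (hj : j ≤ M.n) : M.x i ≤ M.x j :=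
  M.strictMonoOn.monotoneOn (mem_Iic.2 (hij.trans hj)) (mem_Iic.2 hj) hij

lemma x_lt {i j : ℕ} (hij : i < j) (hj : j ≤ M.n) : M.x i < M.x j :=
  M.strictMonoOn (mem_Iic.2 (hij.le.trans hj)) (mem_Iic.2 hj) hij

lemma le_left (hi : i ≤ M.n) : l ≤ M.left i := by
  exact M.x_zero.symm.le.trans (M.x_le (Nat.zero_le _) (by omega))

lemma right_le : M.right i ≤ r := by
  exact (M.x_le (min_le_right _ _) le_rfl).trans M.x_last.le

lemma left_le (hi : i ≤ M.n) : M.left i ≤ M.x i := M.x_le (by omega) hi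

lemma le_right (hi : i ≤ M.n) : M.x i ≤ M.right i := M.x_le (by omega) (min_le_right _ _)

lemma left_lt_right (hlr : l < r) (hi : i ≤ M.n) : M.left i < M.right i :=
  M.x_lt (by have := M.n_pos hlr; omega) (min_le_right _ _)

lemma isPFConst_one (hlr : l < r) (hβ : β ≠ 0) (hi : i ≤ M.n) : M.IsPFConst β i 1 := by
  refine ⟨one_pos, fun _ v g h => ?_, fun _ v g h => ?_⟩
  · rw [mul_one]
    exact poincare (M.left_lt_right hlr hi) h
  · rw [mul_one]
    exact friedrichs hβ (M.left_lt_right hlr hi) h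

/-- Admissible constants are positive by definition, so attaining the infimum needs a positive lower
bound. Testing with `x - c` provides it, `c` being the outflow end of the patch in the Friedrichs
case. -/
lemma exists_pos_le_isPFConst (hlr : l < r) (hβ : β ≠ 0) (hi : i ≤ M.n) :
    ∃ ε > 0, ∀ C, M.IsPFConst β i C → ε ≤ C := by
  have hLR := M.left_lt_right hlr hi
  set L := M.left i
  set R := M.right i
  have hG : 0 < (R - L) * l2norm L R (fun _ => 1) := by
    rw [l2norm_one hLR.le]
    have := sub_pos.2 hLR
    positivity
  have key : ∀ A C : ℝ, A ≤ (R - L) * C * l2norm L R (fun _ => 1) →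
      A / ((R - L) * l2norm L R (fun _ => 1)) ≤ C := by
    intro A C h
    rw [div_le_iff₀ hG]
    linarith
  obtain ⟨c, hc, hout⟩ := exists_outflow_eq hβ hLR.le
  by_cases ho : M.x i ∈ outflow β l r
  · refine ⟨_, div_pos (l2norm_sub_const_pos hLR c) hG, fun C hC => key _ _ ?_⟩
    refine hC.2.2 ho _ _ ⟨memH1_sub_const hLR c, fun d hd => ?_⟩
    rw [(hout d).1 hd]
    exact ⟨fun x => x - c, by fun_prop, ae_eq_refl _, sub_self c⟩
  · refine ⟨_, div_pos (l2norm_sub_const_pos hLR (0 + mean L R (fun x => x - 0))) hG,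
      fun C hC => key _ _ ?_⟩
    have := hC.2.1 ho _ _ (memH1_sub_const hLR 0)
    simpa only [sub_sub] using this

/-- The infimum of the Poincaré–Friedrichs constants is attained. -/
lemma isPFConst_cPF (hlr : l < r) (hβ : β ≠ 0) (hi : i ≤ M.n) :
    M.IsPFConst β i (M.cPF β i) := by
  obtain ⟨ε, hε, hlow⟩ := M.exists_pos_le_isPFConst hlr hβ hi
  have hne : {C | M.IsPFConst β i C}.Nonempty := ⟨1, M.isPFConst_one hlr hβ hi⟩
  have hLR := M.left_lt_right hlr hi
  -- Each inequality is affine in `C`, hence survives the infimum after division by `h G`. If `G =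
  -- 0` the constant drops out and `C = 1` suffices.
  have key : ∀ A G : ℝ, 0 ≤ G →
      (∀ C, M.IsPFConst β i C → A ≤ (M.right i - M.left i) * C * G) →
      A ≤ (M.right i - M.left i) * M.cPF β i * G := by
    intro A G hG hA
    rcases hG.eq_or_lt with rfl | hG
    · simpa using hA 1 (M.isPFConst_one hlr hβ hi)
    · have hpos := mul_pos (sub_pos.2 hLR) hG
      rw [mul_right_comm, ← div_le_iff₀' hpos]
      refine le_csInf hne fun C hC => ?_
      rw [div_le_iff₀' hpos, mul_right_comm]
      exact hA C hC
  refine ⟨hε.trans_le (le_csInf hne hlow), fun ho v g h => ?_, fun ho v g h => ?_⟩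
  · exact key _ _ (l2norm_nonneg _ _ _) fun C hC => hC.2.1 ho v g h
  · exact key _ _ (l2norm_nonneg _ _ _) fun C hC => hC.2.2 ho v g h

lemma cPF_le_one (hlr : l < r) (hβ : β ≠ 0) (hi : i ≤ M.n) : M.cPF β i ≤ 1 :=
  csInf_le ⟨0, fun _ hC => hC.1.le⟩ (M.isPFConst_one hlr hβ hi)

end Mesh

/-! ### Hat functions: partition of unity, derivatives, overlap of patches -/

namespace Mesh

variable {l r : ℝ} (M : Mesh l r) {i : ℕ} {t : ℝ}

lemma left_lt (hi : i ≤ M.n) (h : l < M.x i) : M.left i < M.x i := by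
  refine M.x_lt ?_ hi
  rcases Nat.eq_zero_or_pos i with rfl | h0
  · exact absurd M.x_zero.symm h.ne
  · omega

lemma lt_right (hi : i ≤ M.n) (h : M.x i < r) : M.x i < M.right i := by
  refine M.x_lt ?_ (min_le_right _ _)
  rcases hi.eq_or_lt with rfl | h0
  · exact absurd M.x_last h.ne
  · omega

lemma le_x (hi : i ≤ M.n) : l ≤ M.x i := M.x_zero.symm.le.trans (M.x_le (Nat.zero_le _) hi)

lemma x_le_right_end (hi : i ≤ M.n) : M.x i ≤ r := (M.x_le hi le_rfl).trans M.x_last.le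

lemma exists_mem_Ico (ht : t ∈ Ioo l r) : ∃ j < M.n, M.x j ≤ t ∧ t < M.x (j + 1) := by
  classical
  have hex : ∃ k, t < M.x k := ⟨M.n, ht.2.trans_le M.x_last.symm.le⟩
  have hk := Nat.find_spec hex
  have hkn : Nat.find hex ≤ M.n := Nat.find_min' hex (ht.2.trans_le M.x_last.symm.le)
  have h0 : Nat.find hex ≠ 0 := by
    intro h
    rw [h, M.x_zero] at hk
    exact absurd ht.1 (not_lt.2 hk.le)
  refine ⟨Nat.find hex - 1, by omega, not_lt.1 (Nat.find_min hex (by omega)), ?_⟩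
  rwa [Nat.sub_add_cancel (by omega)]

/-- A point lies in at most two patches. -/
lemma card_patches_le_two (t : ℝ) :
    ((Finset.range (M.n + 1)).filter fun i => t ∈ Ioo (M.left i) (M.right i)).card ≤ 2 := by
  set F := (Finset.range (M.n + 1)).filter fun i => t ∈ Ioo (M.left i) (M.right i) with hF
  rcases F.eq_empty_or_nonempty with h | h
  · simp [h]
  · have hm := F.min'_mem h
    set m := F.min' h
    refine (Finset.card_le_card (t := {m, m + 1}) fun k hk => ?_).trans Finset.card_le_two
    have hmk : m ≤ k := F.min'_le k hk
    rw [hF, Finset.mem_filter, Finset.mem_range] at hm hk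
    have hlt : M.left k < M.right m := hk.2.1.trans hm.2.2
    have : k - 1 < min (m + 1) M.n := by
      by_contra hc
      exact absurd hlt (not_lt.2 (M.x_le (not_lt.1 hc) (by omega)))
    have : k = m ∨ k = m + 1 := by omega
    simpa using this

/-- The restriction to `(l, r)` matters: a boundary vertex is not in its own open patch, yet the hat
is 1 there. -/
lemma hat_eq_zero (hi : i ≤ M.n) (ht : t ∈ Ioo l r) (h : t ∉ Ioo (M.left i) (M.right i)) :
    M.hat i t = 0 := by
  have h1 : t ≠ M.x i := by
    rintro rfl
    exact h ⟨M.left_lt hi ht.1, M.lt_right hi ht.2⟩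
  have h2 : ¬(M.left i < t ∧ t < M.x i) := fun hc =>
    h ⟨hc.1, hc.2.trans_le (M.le_right hi)⟩
  have h3 : ¬(M.x i < t ∧ t < M.right i) := fun hc =>
    h ⟨(M.left_le hi).trans_lt hc.1, hc.2⟩
  rw [hat, if_neg h1, if_neg h2, if_neg h3]

/-- The hat functions form a partition of unity. -/
lemma sum_hat (ht : t ∈ Ioo l r) : ∑ i ∈ Finset.range (M.n + 1), M.hat i t = 1 := by
  obtain ⟨j, hj, h1, h2⟩ := M.exists_mem_Ico ht
  have hjj : M.x j < M.x (j + 1) := M.x_lt (Nat.lt_succ_self j) hj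
  have hrj : M.right j = M.x (j + 1) := by rw [right, min_eq_left (by omega)]
  have hlj : M.left (j + 1) = M.x j := by rw [left, Nat.add_sub_cancel]
  rw [Finset.sum_eq_add_of_mem j (j + 1) (by simp; omega) (by simp; omega) (by omega)]
  · have e1 : M.hat j t = (M.x (j + 1) - t) / (M.x (j + 1) - M.x j) := by
      rcases h1.eq_or_lt with h | h
      · rw [hat, if_pos h.symm, ← h, div_self (sub_pos.2 hjj).ne']
      · rw [hat, if_neg h.ne', if_neg (fun hc => absurd hc.2 (not_lt.2 h.le)), hrj,
          if_pos ⟨h, h2⟩]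
    have e2 : M.hat (j + 1) t = (t - M.x j) / (M.x (j + 1) - M.x j) := by
      rw [hat, if_neg h2.ne, hlj]
      rcases h1.eq_or_lt with h | h
      · rw [if_neg (fun hc => absurd hc.1 (not_lt.2 h.symm.le)),
          if_neg (fun hc => absurd hc.1 (not_lt.2 h2.le)), h, sub_self, zero_div]
      · rw [if_pos ⟨h, h2⟩]
    rw [e1, e2, ← add_div, sub_add_sub_cancel, div_self (sub_pos.2 hjj).ne']
  · intro k hk hkj
    have hk' : k ≤ M.n := by simpa [Nat.lt_succ_iff] using hk
    refine M.hat_eq_zero hk' ht fun hm => ?_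
    rcases lt_or_ge k j with h | h
    · have : M.right k ≤ M.x j := M.x_le (by omega) hj.le
      exact absurd hm.2 (not_lt.2 (this.trans h1))
    · have : M.x (j + 1) ≤ M.left k := M.x_le (by omega) (by omega)
      exact absurd hm.1 (not_lt.2 (h2.le.trans this))

/-- A Lipschitz continuous function on `ℝ` that coincides with the hat function on `(l, r)`. -/
noncomputable def tent (i : ℕ) (t : ℝ) : ℝ :=
  -- At a boundary vertex one denominator is zero, and division by zero makes that branch the
  -- constant 1. It never lowers the minimum below the other branch on the mesh, so one formula
  -- serves all vertices.
  max 0 (min (1 - (M.x i - t) / (M.x i - M.left i)) (1 - (t - M.x i) / (M.right i - M.x i)))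

lemma exists_lipschitzWith_tent (i : ℕ) : ∃ K, LipschitzWith K (M.tent i) := by
  have h : ∀ (a b : ℝ) (F : ℝ → ℝ), (∀ t, F t = a * t + b) → LipschitzWith ‖a‖₊ F := by
    intro a b F hF
    refine LipschitzWith.of_dist_le_mul fun x y => ?_
    rw [Real.dist_eq, Real.dist_eq, coe_nnnorm, Real.norm_eq_abs, ← abs_mul, hF, hF]
    exact le_of_eq (congrArg _ (by ring))
  have h₁ := h (M.x i - M.left i)⁻¹ (1 - M.x i / (M.x i - M.left i))
    (fun t => 1 - (M.x i - t) / (M.x i - M.left i)) fun t => by ring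
  have h₂ := h (-(M.right i - M.x i)⁻¹) (1 + M.x i / (M.right i - M.x i))
    (fun t => 1 - (t - M.x i) / (M.right i - M.x i)) fun t => by ring
  exact ⟨_, (h₁.min h₂).const_max 0⟩

lemma tent_nonneg : 0 ≤ M.tent i t := le_max_left _ _

lemma tent_le_one (hi : i ≤ M.n) : M.tent i t ≤ 1 := by
  refine max_le zero_le_one ?_
  rcases le_total t (M.x i) with h | h
  · exact (min_le_left _ _).trans (sub_le_self _
      (div_nonneg (sub_nonneg.2 h) (sub_nonneg.2 (M.left_le hi))))
  · exact (min_le_right _ _).trans (sub_le_self _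
      (div_nonneg (sub_nonneg.2 h) (sub_nonneg.2 (M.le_right hi))))

lemma tent_left (h : M.left i < M.x i) : M.tent i (M.left i) = 0 := by
  rw [tent, div_self (sub_pos.2 h).ne', sub_self]
  exact max_eq_left (min_le_left _ _)

lemma tent_right (h : M.x i < M.right i) : M.tent i (M.right i) = 0 := by
  rw [tent, div_self (sub_pos.2 h).ne', sub_self]
  exact max_eq_left (min_le_right _ _)

/-- On each side of the vertex the branch belonging to the other side is at least 1 and loses the
minimum. -/
lemma hat_eq_tent (hi : i ≤ M.n) (ht : t ∈ Ioo l r) : M.hat i t = M.tent i t := by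
  rcases lt_trichotomy t (M.x i) with h | rfl | h
  · have hl := M.left_lt hi (ht.1.trans h)
    have hd := sub_pos.2 hl
    have hq : 1 ≤ 1 - (t - M.x i) / (M.right i - M.x i) := by
      have := div_nonneg (sub_nonneg.2 h.le) (sub_nonneg.2 (M.le_right hi))
      rw [← neg_sub t, neg_div] at this
      linarith
    have hp : 1 - (M.x i - t) / (M.x i - M.left i)
        = (t - M.left i) / (M.x i - M.left i) := by
      field_simp
      ring
    have hp1 : 1 - (M.x i - t) / (M.x i - M.left i) ≤ 1 :=
      sub_le_self _ (div_nonneg (sub_nonneg.2 h.le) hd.le)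
    rw [tent, min_eq_left (hp1.trans hq), hp, hat, if_neg h.ne]
    by_cases hL : M.left i < t
    · rw [if_pos ⟨hL, h⟩, max_eq_right (div_nonneg (sub_nonneg.2 hL.le) hd.le)]
    · rw [if_neg (fun hc => hL hc.1), if_neg (fun hc => absurd hc.1 (not_lt.2 h.le)),
        max_eq_left (div_nonpos_of_nonpos_of_nonneg (sub_nonpos.2 (not_lt.1 hL)) hd.le)]
  · simp [hat, tent]
  · have hl := M.lt_right hi (h.trans ht.2)
    have hd := sub_pos.2 hl
    have hq : 1 ≤ 1 - (M.x i - t) / (M.x i - M.left i) := by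
      have := div_nonneg (sub_nonneg.2 h.le) (sub_nonneg.2 (M.left_le hi))
      rw [← neg_sub, neg_div] at this
      linarith
    have hp : 1 - (t - M.x i) / (M.right i - M.x i)
        = (M.right i - t) / (M.right i - M.x i) := by
      field_simp
      ring
    have hp1 : 1 - (t - M.x i) / (M.right i - M.x i) ≤ 1 :=
      sub_le_self _ (div_nonneg (sub_nonneg.2 h.le) hd.le)
    rw [tent, min_eq_right (hp1.trans hq), hp, hat, if_neg h.ne',
      if_neg (fun hc => absurd hc.2 (not_lt.2 h.le))]
    by_cases hL : t < M.right i
    · rw [if_pos ⟨h, hL⟩, max_eq_right (div_nonneg (sub_nonneg.2 hL.le) hd.le)]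
    · rw [if_neg (fun hc => hL hc.2),
        max_eq_left (div_nonpos_of_nonpos_of_nonneg (sub_nonpos.2 (not_lt.1 hL)) hd.le)]

lemma hat_eventuallyEq_tent (hi : i ≤ M.n) (ht : t ∈ Ioo l r) :
    M.hat i =ᶠ[nhds t] M.tent i := by
  filter_upwards [isOpen_Ioo.mem_nhds ht] with s hs using M.hat_eq_tent hi hs

lemma deriv_hat_eq_deriv_tent (hi : i ≤ M.n) (ht : t ∈ Ioo l r) :
    deriv (M.hat i) t = deriv (M.tent i) t :=
  (M.hat_eventuallyEq_tent hi ht).deriv_eq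

lemma hasACDeriv_tent {L R : ℝ} (hi : i ≤ M.n) (hL : l ≤ L) (hLR : L ≤ R) (hR : R ≤ r) :
    HasACDeriv L R (M.tent i) (deriv (M.hat i)) := by
  obtain ⟨K, hK⟩ := M.exists_lipschitzWith_tent i
  refine (hK.lipschitzOnWith.absolutelyContinuousOnInterval.hasACDeriv hLR).congr_deriv ?_
  filter_upwards [ae_restrict_mem measurableSet_Ioo] with x hx
  exact (M.deriv_hat_eq_deriv_tent hi (Ioo_subset_Ioo hL hR hx)).symm

lemma aestronglyMeasurable_hat (hi : i ≤ M.n) :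
    AEStronglyMeasurable (M.hat i) (volume.restrict (Ioo l r)) := by
  obtain ⟨K, hK⟩ := M.exists_lipschitzWith_tent i
  refine hK.continuous.aestronglyMeasurable.congr ?_
  filter_upwards [ae_restrict_mem measurableSet_Ioo] with x hx
  exact (M.hat_eq_tent hi hx).symm

lemma abs_hat_le_one (hi : i ≤ M.n) (ht : t ∈ Ioo l r) : |M.hat i t| ≤ 1 := by
  rw [M.hat_eq_tent hi ht, abs_of_nonneg M.tent_nonneg]
  exact M.tent_le_one hi

lemma hatGradSup_nonneg (i : ℕ) : 0 ≤ M.hatGradSup i := ENNReal.toReal_nonneg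

lemma ae_abs_deriv_hat_le (hi : i ≤ M.n) :
    ∀ᵐ t ∂volume.restrict (Ioo l r), |deriv (M.hat i) t| ≤ M.hatGradSup i := by
  obtain ⟨K, hK⟩ := M.exists_lipschitzWith_tent i
  -- Finiteness comes first: `toReal` would turn an infinite norm into 0.
  have hfin : eLpNorm (deriv (M.hat i)) ⊤ (volume.restrict (Ioo l r)) ≠ ⊤ := by
    refine (MemLp.of_bound (measurable_deriv _).aestronglyMeasurable K ?_).2.ne
    filter_upwards [ae_restrict_mem measurableSet_Ioo] with x hx
    rw [M.deriv_hat_eq_deriv_tent hi hx]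
    exact norm_deriv_le_of_lipschitz hK
  rw [eLpNorm_exponent_top] at hfin
  filter_upwards [ae_le_eLpNormEssSup (f := deriv (M.hat i))
    (μ := volume.restrict (Ioo l r))] with x hx
  rw [hatGradSup, eLpNorm_exponent_top]
  simpa using ENNReal.toReal_mono hfin hx

lemma ae_deriv_hat_eq_zero (hi : i ≤ M.n) : ∀ᵐ t ∂volume.restrict (Ioo l r),
    t ∉ Ioo (M.left i) (M.right i) → deriv (M.hat i) t = 0 := by
  have hL : ∀ᵐ t : ℝ, t ≠ M.left i := by simp [ae_iff, measure_singleton]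
  have hR : ∀ᵐ t : ℝ, t ≠ M.right i := by simp [ae_iff, measure_singleton]
  filter_upwards [ae_restrict_mem measurableSet_Ioo, ae_restrict_of_ae hL,
    ae_restrict_of_ae hR] with t ht htL htR hm
  have hm' : t ∈ (Icc (M.left i) (M.right i))ᶜ := fun hc =>
    hm ⟨hc.1.lt_of_ne htL.symm, hc.2.lt_of_ne htR⟩
  have : M.hat i =ᶠ[nhds t] fun _ => 0 := by
    filter_upwards [isOpen_Ioo.mem_nhds ht, isClosed_Icc.isOpen_compl.mem_nhds hm'] with s hs hs'
    exact M.hat_eq_zero hi hs fun hc => hs' (Ioo_subset_Icc_self hc)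
  rw [this.deriv_eq, deriv_const]

/-- Differentiate the partition of unity, which holds in a neighbourhood of every point of `(l, r)`.
-/
lemma ae_sum_deriv_hat (hlr : l ≤ r) : ∀ᵐ t ∂volume.restrict (Ioo l r),
    ∑ i ∈ Finset.range (M.n + 1), deriv (M.hat i) t = 0 := by
  have hd : ∀ᵐ t ∂volume.restrict (Ioo l r), ∀ i ∈ Finset.range (M.n + 1),
      HasDerivAt (M.tent i) (deriv (M.hat i) t) t := by
    rw [Finset.eventually_all]
    intro i hi
    exact (M.hasACDeriv_tent (Nat.lt_succ_iff.1 (Finset.mem_range.1 hi)) le_rfl hlr le_rfl).2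
  filter_upwards [ae_restrict_mem measurableSet_Ioo, hd] with t ht h
  refine (HasDerivAt.fun_sum h).unique ?_
  refine (hasDerivAt_const t (1 : ℝ)).congr_of_eventuallyEq ?_
  filter_upwards [isOpen_Ioo.mem_nhds ht] with s hs
  rw [← M.sum_hat hs]
  exact Finset.sum_congr rfl fun i hi =>
    (M.hat_eq_tent (Nat.lt_succ_iff.1 (Finset.mem_range.1 hi)) hs).symm

/-- The patches cover every point at most twice. -/
lemma sum_l2norm_sq_le {g : ℝ → ℝ} (hg : MemL2 l r g) :
    ∑ i ∈ Finset.range (M.n + 1), l2norm (M.left i) (M.right i) g ^ 2 ≤ 2 * l2norm l r g ^ 2 := by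
  have e : ∀ i ∈ Finset.range (M.n + 1), l2norm (M.left i) (M.right i) g ^ 2
      = ip l r g ((Ioo (M.left i) (M.right i)).indicator g) := by
    intro i hi
    rw [ip_indicator_right (M.le_left (Nat.lt_succ_iff.1 (Finset.mem_range.1 hi))) M.right_le,
      l2norm_sq]
  have hind : ∀ i ∈ Finset.range (M.n + 1),
      MemL2 l r ((Ioo (M.left i) (M.right i)).indicator g) := fun i hi =>
    have h := M.le_left (Nat.lt_succ_iff.1 (Finset.mem_range.1 hi))
    MemL2.indicator h M.right_le (hg.mono h M.right_le)
  rw [Finset.sum_congr rfl e, ← ip_sum_right _ _ hg hind, l2norm_sq, ip, ip, ← integral_const_mul]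
  refine integral_mono (hg.integrable_mul (MemL2.sum _ hind)) ((hg.integrable_mul hg).const_mul 2)
    fun t => ?_
  simp only [indicator_apply]
  -- The integrand is `g²` times the number of patches containing `t`.
  rw [← Finset.sum_filter, Finset.sum_const, nsmul_eq_mul, mul_left_comm]
  refine mul_le_mul_of_nonneg_right ?_ (mul_self_nonneg _)
  exact_mod_cast M.card_patches_le_two t

/-- At each point at most two summands survive, so the squared sum is at most twice the sum of
squares. -/
lemma l2norm_sum_indicator_sq_le {q : ℕ → ℝ → ℝ}
    (hq : ∀ i ∈ Finset.range (M.n + 1), MemL2 (M.left i) (M.right i) (q i)) :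
    l2norm l r (fun t => ∑ i ∈ Finset.range (M.n + 1),
      (Ioo (M.left i) (M.right i)).indicator (q i) t) ^ 2 ≤
    2 * ∑ i ∈ Finset.range (M.n + 1), l2norm (M.left i) (M.right i) (q i) ^ 2 := by
  have hind : ∀ i ∈ Finset.range (M.n + 1),
      MemL2 l r ((Ioo (M.left i) (M.right i)).indicator (q i)) := fun i hi =>
    (hq i hi).indicator (M.le_left (Nat.lt_succ_iff.1 (Finset.mem_range.1 hi))) M.right_le
  have e : ∀ i ∈ Finset.range (M.n + 1), l2norm (M.left i) (M.right i) (q i) ^ 2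
      = ∫ t in Ioo l r, (Ioo (M.left i) (M.right i)).indicator (q i) t *
        (Ioo (M.left i) (M.right i)).indicator (q i) t := by
    intro i hi
    rw [← l2norm_indicator (M.le_left (Nat.lt_succ_iff.1 (Finset.mem_range.1 hi))) M.right_le,
      l2norm_sq, ip]
  have hint := fun i hi => (hind i hi).integrable_mul (hind i hi)
  rw [Finset.sum_congr rfl e, ← integral_finsetSum _ hint, ← integral_const_mul, l2norm_sq, ip]
  refine integral_mono ((MemL2.sum _ hind).integrable_mul (MemL2.sum _ hind))
    ((integrable_finsetSum _ hint).const_mul 2) fun t => ?_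
  simp only [indicator_apply, ite_mul, zero_mul, ← Finset.sum_filter]
  have hs : ∀ i ∈ (Finset.range (M.n + 1)).filter fun i => t ∈ Ioo (M.left i) (M.right i),
      (q i t * if t ∈ Ioo (M.left i) (M.right i) then q i t else 0) = q i t ^ 2 := by
    intro i hi
    rw [if_pos (Finset.mem_filter.1 hi).2, sq]
  rw [Finset.sum_congr rfl hs, ← sq]
  refine sq_sum_le_card_mul_sum_sq.trans (mul_le_mul_of_nonneg_right ?_
    (Finset.sum_nonneg fun i _ => sq_nonneg _))
  exact_mod_cast M.card_patches_le_two t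

end Mesh

/-! ### Linearity and boundedness of the residual -/

section Residual

variable {β l r : ℝ} {f u v g v₁ g₁ v₂ g₂ : ℝ → ℝ}

lemma residual_congr (hv : v₁ =ᵐ[volume.restrict (Ioo l r)] v₂)
    (hg : g₁ =ᵐ[volume.restrict (Ioo l r)] g₂) :
    residual β l r f u v₁ g₁ = residual β l r f u v₂ g₂ := by
  rw [residual, residual, ip_congr (ae_eq_refl f) hv, ip_congr (ae_eq_refl u)
    (show (fun x => β * g₁ x) =ᵐ[volume.restrict (Ioo l r)] fun x => β * g₂ x by
      filter_upwards [hg] with x hx; rw [hx])]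

lemma residual_sum {ι : Type*} (s : Finset ι) {q p : ι → ℝ → ℝ} (hf : MemL2 l r f)
    (hu : MemL2 l r u) (hq : ∀ i ∈ s, MemL2 l r (q i)) (hp : ∀ i ∈ s, MemL2 l r (p i)) :
    residual β l r f u (fun x => ∑ i ∈ s, q i x) (fun x => ∑ i ∈ s, p i x)
      = ∑ i ∈ s, residual β l r f u (q i) (p i) := by
  simp only [residual, Finset.sum_add_distrib, Finset.mul_sum]
  rw [ip_sum_right s q hf hq, ip_sum_right s (fun i x => β * p i x) hu
    fun i hi => (hp i hi).const_mul β]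

lemma residual_add (hf : MemL2 l r f) (hu : MemL2 l r u) (hv₁ : MemL2 l r v₁)
    (hv₂ : MemL2 l r v₂) (hg₁ : MemL2 l r g₁) (hg₂ : MemL2 l r g₂) :
    residual β l r f u (fun x => v₁ x + v₂ x) (fun x => g₁ x + g₂ x)
      = residual β l r f u v₁ g₁ + residual β l r f u v₂ g₂ := by
  simp only [residual, mul_add]
  rw [ip_add_right hf hv₁ hv₂, ip_add_right hu (hg₁.const_mul β) (hg₂.const_mul β)]
  ring

lemma residual_const_mul (c : ℝ) :
    residual β l r f u (fun x => c * v x) (fun x => c * g x) = c * residual β l r f u v g := by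
  simp only [residual, mul_left_comm β c, ip_const_mul_right]
  ring

lemma MemH1plus.const_mul (c : ℝ) (h : MemH1plus β l r v g) :
    MemH1plus β l r (fun x => c * v x) (fun x => c * g x) := by
  refine ⟨⟨h.1.1.const_mul c, h.1.2.1.const_mul c, fun φ h1 h2 h3 => ?_⟩, fun d hd => ?_⟩
  · rw [ip_comm, ip_const_mul_right, ip_comm, h.1.2.2 φ h1 h2 h3,
      ip_comm l r (fun x => c * g x), ip_const_mul_right, ip_comm l r φ, mul_neg]
  · obtain ⟨w, hw, hvw, hwd⟩ := h.2 d hd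
    exact ⟨fun x => c * w x, continuousOn_const.mul hw,
      by filter_upwards [hvw] with x hx; rw [hx], by simp [hwd]⟩

lemma MemH1plus.sum {ι : Type*} (s : Finset ι) {q p : ι → ℝ → ℝ}
    (h : ∀ i ∈ s, MemH1plus β l r (q i) (p i)) :
    MemH1plus β l r (fun x => ∑ i ∈ s, q i x) (fun x => ∑ i ∈ s, p i x) := by
  have hq : ∀ i ∈ s, MemL2 l r (q i) := fun i hi => (h i hi).1.1
  have hp : ∀ i ∈ s, MemL2 l r (p i) := fun i hi => (h i hi).1.2.1
  refine ⟨⟨MemL2.sum s hq, MemL2.sum s hp, fun φ h1 h2 h3 => ?_⟩, fun d hd => ?_⟩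
  · have hφ : MemL2 l r φ := h1.continuous.continuousOn.memL2
    have hφ' : MemL2 l r (deriv φ) := (h1.continuous_deriv (by simp)).continuousOn.memL2
    rw [ip_comm, ip_sum_right s q hφ' hq, ip_comm, ip_sum_right s p hφ hp,
      ← Finset.sum_neg_distrib]
    refine Finset.sum_congr rfl fun i hi => ?_
    rw [ip_comm, (h i hi).1.2.2 φ h1 h2 h3, ip_comm]
  · have hex : ∀ i, ∃ w : ℝ → ℝ, i ∈ s → ContinuousOn w (Icc l r) ∧
        q i =ᵐ[volume.restrict (Ioo l r)] w ∧ w d = 0 := by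
      intro i
      by_cases hi : i ∈ s
      · obtain ⟨w, hw⟩ := (h i hi).2 d hd
        exact ⟨w, fun _ => hw⟩
      · exact ⟨0, fun hi' => absurd hi' hi⟩
    choose w hw using hex
    refine ⟨fun x => ∑ i ∈ s, w i x, continuousOn_finsetSum s fun i hi => (hw i hi).1, ?_,
      Finset.sum_eq_zero fun i hi => (hw i hi).2.2⟩
    have := (Finset.eventually_all s).2 fun i hi => (hw i hi).2.1
    filter_upwards [this] with x hx
    exact Finset.sum_congr rfl fun i hi => hx i hi

/-- The residual is bounded on `H¹₊(Ω)`. -/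
lemma residual_le_mul_l2norm (hβ : β ≠ 0) (hlr : l < r) (hf : MemL2 l r f) (hu : MemL2 l r u)
    (h : MemH1plus β l r v g) :
    residual β l r f u v g ≤
      (l2norm l r f * ((r - l) / |β|) + l2norm l r u) * l2norm l r (fun x => β * g x) := by
  have h1 := (le_abs_self _).trans (abs_ip_le hf h.1.1)
  have h2 := (le_abs_self _).trans (abs_ip_le hu (h.1.2.1.const_mul β))
  have h3 := mul_le_mul_of_nonneg_left (friedrichs hβ hlr h) (l2norm_nonneg l r f)
  have h4 : (r - l) * l2norm l r g = (r - l) / |β| * l2norm l r (fun x => β * g x) := by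
    rw [l2norm_const_mul]
    field_simp [abs_pos.2 hβ]
  rw [h4] at h3
  rw [residual]
  linarith

lemma bddAbove_globalQuotients (hβ : β ≠ 0) (hlr : l < r) (hf : MemL2 l r f)
    (hu : MemL2 l r u) : BddAbove (globalQuotients β l r f u) := by
  refine ⟨l2norm l r f * ((r - l) / |β|) + l2norm l r u, ?_⟩
  rintro t ⟨v, g, h, -, rfl⟩
  refine div_le_of_le_mul₀ (l2norm_nonneg _ _ _) ?_ (residual_le_mul_l2norm hβ hlr hf hu h)
  have := l2norm_nonneg l r f
  have := l2norm_nonneg l r u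
  have := sub_pos.2 hlr
  positivity

/-- The quotients exclude `v = 0`, whereas dividing requires a nonzero gradient norm; this
reconciles the two conditions. -/
lemma not_ae_eq_zero_of_l2norm_pos (hlr : l < r) (h : MemH1 l r v g)
    (hpos : 0 < l2norm l r (fun x => β * g x)) : ¬ v =ᵐ[volume.restrict (Ioo l r)] 0 := by
  intro hv
  obtain ⟨w, hw, hvw⟩ := h.exists_hasACDeriv hlr
  have h0 := eqOn_Icc_of_ae_eq_Ioo hlr (hw.continuousOn hlr.le) continuousOn_const
    (hvw.symm.trans hv)
  have hg : (fun x => β * g x) =ᵐ[volume.restrict (Ioo l r)] fun _ => 0 := by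
    filter_upwards [hw.2, ae_restrict_mem measurableSet_Ioo] with x hx hxm
    have : HasDerivAt w 0 x := (hasDerivAt_const x (0 : ℝ)).congr_of_eventuallyEq (by
      filter_upwards [isOpen_Ioo.mem_nhds hxm] with s hs using h0 (Ioo_subset_Icc_self hs))
    rw [hx.unique this, mul_zero]
  rw [l2norm_congr hg] at hpos
  simp [l2norm, ip] at hpos

lemma residual_le_globalDualNorm_mul (hβ : β ≠ 0) (hlr : l < r) (hf : MemL2 l r f)
    (hu : MemL2 l r u) (h : MemH1plus β l r v g) :
    residual β l r f u v g ≤ globalDualNorm β l r f u * l2norm l r (fun x => β * g x) := by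
  rcases (l2norm_nonneg l r (fun x => β * g x)).eq_or_lt with h0 | h0
  -- With zero gradient norm the quotient is useless, but the a priori bound makes the residual
  -- nonpositive.
  · have := residual_le_mul_l2norm hβ hlr hf hu h
    rwa [← h0, mul_zero] at this ⊢
  · rw [← div_le_iff₀ h0]
    exact le_csSup (bddAbove_globalQuotients hβ hlr hf hu)
      ⟨v, g, h, not_ae_eq_zero_of_l2norm_pos hlr h.1 h0, rfl⟩

/-- The set of quotients is symmetric under `v ↦ -v`, and the supremum of the empty set is 0. -/
lemma globalDualNorm_nonneg (hβ : β ≠ 0) (hlr : l < r) (hf : MemL2 l r f)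
    (hu : MemL2 l r u) : 0 ≤ globalDualNorm β l r f u := by
  rcases (globalQuotients β l r f u).eq_empty_or_nonempty with he | ⟨t, ht⟩
  · rw [globalDualNorm, he, Real.sSup_empty]
  · have hneg : -t ∈ globalQuotients β l r f u := by
      obtain ⟨v, g, h, hv, rfl⟩ := ht
      refine ⟨_, _, h.const_mul (-1), fun h0 => hv ?_, ?_⟩
      · filter_upwards [h0] with x hx
        simpa using hx
      · rw [residual_const_mul]
        simp only [mul_left_comm β (-1)]
        rw [l2norm_const_mul (v := fun x => β * g x) (-1)]
        simp [neg_div]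
    have hb := bddAbove_globalQuotients hβ hlr hf hu
    have h1 := le_csSup hb ht
    have h2 := le_csSup hb hneg
    rw [globalDualNorm]
    linarith

end Residual

/-! ### Zero extension and the bound of the local dual norms by the global one -/

namespace Mesh

variable {β l r : ℝ} (M : Mesh l r) {i : ℕ} {f u v g : ℝ → ℝ}

lemma MemPatchSpace.memH1 {M : Mesh l r} (h : M.MemPatchSpace β i v g) :
    MemH1 (M.left i) (M.right i) v g := by
  by_cases hi : M.x i ∈ inflow β l r
  · exact (h.1 hi).1
  · exact (h.2 hi).1

/-- Extension by zero maps the patchwise space into `H¹₊(Ω)`. -/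
lemma MemPatchSpace.memH1plus_zeroExt {M : Mesh l r} (hβ : β ≠ 0) (hlr : l < r) (hi : i ≤ M.n)
    (h : M.MemPatchSpace β i v g) :
    MemH1plus β l r (M.zeroExt i v) (M.zeroExt i g) := by
  have hLR := M.left_lt_right hlr hi
  have hL := M.le_left hi
  have hR := M.right_le (i := i)
  obtain ⟨w, hw, hvw⟩ := h.memH1.exists_hasACDeriv hLR
  have hwc := hw.continuousOn hLR.le
  have hz : ∀ c ∈ Icc (M.left i) (M.right i), ZeroTrace (M.left i) (M.right i) v c → w c = 0 :=
    fun c hc h0 => h0.eq_zero hLR hwc hvw hc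
  have hlm := left_mem_Icc.2 hLR.le
  have hrm := right_mem_Icc.2 hLR.le
  -- At each patch end `w` vanishes, unless that end is the inflow end of Ω. Recording the sign of
  -- `β` rules out the exception at the outflow end.
  have hbd : (M.left i = l ∧ 0 < β ∨ w (M.left i) = 0) ∧
      (M.right i = r ∧ β < 0 ∨ w (M.right i) = 0) := by
    by_cases hin : M.x i ∈ inflow β l r
    · have hplus := h.1 hin
      rcases hβ.lt_or_gt with hb | hb
      · rw [mem_inflow_of_neg hb] at hin
        exact ⟨Or.inr (hz _ hlm (hplus.2 _ ((mem_outflow_of_neg hb).2 rfl))),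
          Or.inl ⟨le_antisymm hR (hin.symm.le.trans (M.le_right hi)), hb⟩⟩
      · rw [mem_inflow_of_pos hb] at hin
        exact ⟨Or.inl ⟨le_antisymm ((M.left_le hi).trans hin.le) hL, hb⟩,
          Or.inr (hz _ hrm (hplus.2 _ ((mem_outflow_of_pos hb).2 rfl)))⟩
    · exact ⟨Or.inr (hz _ hlm (h.2 hin).2.1), Or.inr (hz _ hrm (h.2 hin).2.2)⟩
  obtain ⟨z, hz1, hz2, hzl, hzr⟩ := hw.exists_indicator hL hLR hR (hbd.1.imp_left And.left)
    (hbd.2.imp_left And.left)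
  have hext : M.zeroExt i v =ᵐ[volume.restrict (Ioo l r)] z := by
    filter_upwards [ae_restrict_of_ae ((ae_restrict_iff' measurableSet_Ioo).1 hvw),
      ae_restrict_mem measurableSet_Ioo] with x hx hxm
    rw [hz2 hxm, zeroExt]
    by_cases hxi : x ∈ Ioo (M.left i) (M.right i)
    · rw [indicator_of_mem hxi, indicator_of_mem hxi, hx hxi]
    · rw [indicator_of_notMem hxi, indicator_of_notMem hxi]
  refine ⟨hz1.memH1 hlr.le (h.memH1.2.1.indicator hL hR) hext, fun c hc => ?_⟩
  refine ⟨z, hz1.continuousOn hlr.le, hext, ?_⟩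
  rcases hβ.lt_or_gt with hb | hb
  · rw [(mem_outflow_of_neg hb).1 hc]
    exact hzl (hbd.1.resolve_left fun h => absurd h.2 hb.not_gt)
  · rw [(mem_outflow_of_pos hb).1 hc]
    exact hzr (hbd.2.resolve_left fun h => absurd h.2 hb.not_gt)

lemma l2norm_mul_zeroExt (hi : i ≤ M.n) (c : ℝ) (g : ℝ → ℝ) :
    l2norm l r (fun x => c * M.zeroExt i g x)
      = l2norm (M.left i) (M.right i) (fun x => c * g x) := by
  rw [l2norm_const_mul, l2norm_const_mul, zeroExt, l2norm_indicator (M.le_left hi) M.right_le]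

lemma localQuotients_subset (hβ : β ≠ 0) (hlr : l < r) (hi : i ≤ M.n) :
    M.localQuotients β f u i ⊆ globalQuotients β l r f u := by
  rintro t ⟨v, g, h, hv, rfl⟩
  refine ⟨_, _, h.memH1plus_zeroExt hβ hlr hi, fun h0 => hv ?_, ?_⟩
  · filter_upwards [ae_restrict_of_ae_restrict_of_subset
      (Ioo_subset_Ioo (M.le_left hi) M.right_le) h0, ae_restrict_mem measurableSet_Ioo] with x hx hm
    rwa [zeroExt, indicator_of_mem hm] at hx
  · rw [M.l2norm_mul_zeroExt hi]

lemma bddAbove_localQuotients (hβ : β ≠ 0) (hlr : l < r) (hi : i ≤ M.n) (hf : MemL2 l r f)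
    (hu : MemL2 l r u) : BddAbove (M.localQuotients β f u i) :=
  (bddAbove_globalQuotients hβ hlr hf hu).mono (M.localQuotients_subset hβ hlr hi)

lemma residual_le_localDualNorm_mul (hβ : β ≠ 0) (hlr : l < r) (hi : i ≤ M.n)
    (hf : MemL2 l r f) (hu : MemL2 l r u) (h : M.MemPatchSpace β i v g) :
    residual β l r f u (M.zeroExt i v) (M.zeroExt i g) ≤
      M.localDualNorm β f u i * l2norm (M.left i) (M.right i) (fun x => β * g x) := by
  rcases (l2norm_nonneg (M.left i) (M.right i) (fun x => β * g x)).eq_or_lt with h0 | h0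
  · have := residual_le_mul_l2norm hβ hlr hf hu (h.memH1plus_zeroExt hβ hlr hi)
    rw [M.l2norm_mul_zeroExt hi, ← h0, mul_zero] at this
    rwa [← h0, mul_zero]
  · rw [← div_le_iff₀ h0]
    exact le_csSup (M.bddAbove_localQuotients hβ hlr hi hf hu)
      ⟨v, g, h, not_ae_eq_zero_of_l2norm_pos (M.left_lt_right hlr hi) h.memH1 h0, rfl⟩

/-- Stated for arbitrary members of the patchwise spaces, so that no local maximizer has to exist.
-/
lemma sum_sq_quotients_le (hβ : β ≠ 0) (hlr : l < r) (hf : MemL2 l r f) (hu : MemL2 l r u)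
    {v g : ℕ → ℝ → ℝ} (h : ∀ i ∈ Finset.range (M.n + 1), M.MemPatchSpace β i (v i) (g i)) :
    ∑ i ∈ Finset.range (M.n + 1), (residual β l r f u (M.zeroExt i (v i)) (M.zeroExt i (g i)) /
      l2norm (M.left i) (M.right i) (fun x => β * g i x)) ^ 2 ≤
    2 * globalDualNorm β l r f u ^ 2 := by
  set ρ : ℕ → ℝ := fun i => residual β l r f u (M.zeroExt i (v i)) (M.zeroExt i (g i)) with hρ
  set N : ℕ → ℝ := fun i => l2norm (M.left i) (M.right i) (fun x => β * g i x) with hN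
  -- With this scaling the residual and the squared norm of the `i`-th term both equal the squared
  -- quotient; for `N i = 0` all of `c i`, quotient and norm are 0.
  set c : ℕ → ℝ := fun i => ρ i / N i / N i with hc
  set G := globalDualNorm β l r f u with hG
  change ∑ i ∈ Finset.range (M.n + 1), (ρ i / N i) ^ 2 ≤ 2 * G ^ 2
  set S := ∑ i ∈ Finset.range (M.n + 1), (ρ i / N i) ^ 2 with hS
  have hmem : ∀ i ∈ Finset.range (M.n + 1), MemH1plus β l r
      (fun x => c i * M.zeroExt i (v i) x) (fun x => c i * M.zeroExt i (g i) x) := fun i hi =>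
    ((h i hi).memH1plus_zeroExt hβ hlr (Nat.lt_succ_iff.1 (Finset.mem_range.1 hi))).const_mul _
  have h1 := residual_le_globalDualNorm_mul hβ hlr hf hu (MemH1plus.sum _ hmem)
  rw [residual_sum _ hf hu (fun i hi => (hmem i hi).1.1) (fun i hi => (hmem i hi).1.2.1)] at h1
  have e1 : ∑ i ∈ Finset.range (M.n + 1), residual β l r f u
      (fun x => c i * M.zeroExt i (v i) x) (fun x => c i * M.zeroExt i (g i) x) = S := by
    refine Finset.sum_congr rfl fun i _ => ?_
    rw [residual_const_mul]
    change ρ i / N i / N i * ρ i = _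
    ring
  rw [e1] at h1
  set K := l2norm l r (fun x => β * ∑ i ∈ Finset.range (M.n + 1), c i * M.zeroExt i (g i) x)
    with hK
  have h2 : K ^ 2 ≤ 2 * S := by
    have hq := M.l2norm_sum_indicator_sq_le (q := fun i x => c i * (β * g i x))
      fun i hi => ((h i hi).memH1.2.1.const_mul β).const_mul (c i)
    have e2 : ∀ x, (∑ i ∈ Finset.range (M.n + 1),
        (Ioo (M.left i) (M.right i)).indicator (fun x => c i * (β * g i x)) x)
        = β * ∑ i ∈ Finset.range (M.n + 1), c i * M.zeroExt i (g i) x := by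
      intro x
      rw [Finset.mul_sum]
      refine Finset.sum_congr rfl fun i _ => ?_
      rw [zeroExt]
      by_cases hx : x ∈ Ioo (M.left i) (M.right i)
      · rw [indicator_of_mem hx, indicator_of_mem hx]
        ring
      · rw [indicator_of_notMem hx, indicator_of_notMem hx]
        ring
    simp only [e2] at hq
    refine hq.trans (mul_le_mul_of_nonneg_left (Finset.sum_le_sum fun i _ => ?_) zero_le_two)
    rw [l2norm_const_mul, mul_pow, sq_abs]
    change (ρ i / N i / N i) ^ 2 * N i ^ 2 ≤ _
    by_cases h0 : N i = 0
    · simp [h0]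
    · rw [← mul_pow, div_mul_cancel₀ _ h0]
  have hS0 : 0 ≤ S := Finset.sum_nonneg fun i _ => sq_nonneg _
  -- From `S ≤ G K` and `K² ≤ 2 S`; dividing by `S` gives the claim.
  have h3 : S * S ≤ 2 * G ^ 2 * S := by
    have := mul_self_le_mul_self hS0 h1
    nlinarith [mul_le_mul_of_nonneg_left h2 (sq_nonneg G)]
  rcases hS0.eq_or_lt with h0 | h0
  · rw [← h0]
    positivity
  · exact le_of_mul_le_mul_right h3 h0

lemma memPatchSpace_zero (i : ℕ) : M.MemPatchSpace β i (fun _ => 0) (fun _ => 0) := by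
  have h1 : MemH1 (M.left i) (M.right i) (fun _ => 0) (fun _ => 0) :=
    ⟨memL2_const 0, memL2_const 0, fun φ _ _ _ => by simp [ip]⟩
  have h2 : ∀ c, ZeroTrace (M.left i) (M.right i) (fun _ => 0) c := fun c =>
    ⟨fun _ => 0, continuousOn_const, ae_eq_refl _, rfl⟩
  exact ⟨fun _ => ⟨h1, fun c _ => h2 c⟩, fun _ => ⟨h1, h2 _, h2 _⟩⟩

/-- The localized dual norms are bounded by the global one. -/
lemma sum_localDualNorm_sq_le (hβ : β ≠ 0) (hlr : l < r) (hf : MemL2 l r f) (hu : MemL2 l r u) :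
    ∑ i ∈ Finset.range (M.n + 1), M.localDualNorm β f u i ^ 2 ≤
      2 * globalDualNorm β l r f u ^ 2 := by
  -- One maximizing sequence per vertex; the bound for fixed `k` then passes to the limit in the
  -- finite sum.
  have hseq : ∀ i, ∃ v g : ℕ → ℝ → ℝ, i ∈ Finset.range (M.n + 1) →
      (∀ k, M.MemPatchSpace β i (v k) (g k)) ∧
      Filter.Tendsto (fun k => residual β l r f u (M.zeroExt i (v k)) (M.zeroExt i (g k)) /
        l2norm (M.left i) (M.right i) (fun x => β * g k x)) Filter.atTop
        (nhds (M.localDualNorm β f u i)) := by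
    intro i
    by_cases hi : i ∈ Finset.range (M.n + 1)
    · rcases (M.localQuotients β f u i).eq_empty_or_nonempty with he | hne
      -- Here the supremum is 0 by convention, matched by the zero function through `0 / 0 = 0`.
      · refine ⟨fun _ _ => 0, fun _ _ => 0, fun _ => ⟨fun _ => M.memPatchSpace_zero i, ?_⟩⟩
        rw [localDualNorm, he, Real.sSup_empty]
        simp [l2norm, ip]
      · obtain ⟨s, -, hs, hmem⟩ := exists_seq_tendsto_sSup hne
          (M.bddAbove_localQuotients hβ hlr (Nat.lt_succ_iff.1 (Finset.mem_range.1 hi)) hf hu)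
        choose v g hvg _ heq using hmem
        refine ⟨v, g, fun _ => ⟨hvg, ?_⟩⟩
        simp only [← heq]
        exact hs
    · exact ⟨fun _ _ => 0, fun _ _ => 0, fun h => absurd h hi⟩
  choose v g hvg using hseq
  refine le_of_tendsto (tendsto_finsetSum _ fun i hi => (hvg i hi).2.pow 2)
    (Filter.Eventually.of_forall fun k => ?_)
  exact M.sum_sq_quotients_le hβ hlr hf hu (v := fun i => v i k) (g := fun i => g i k)
    fun i hi => (hvg i hi).1 k

end Mesh

/-! ### Cut-off by hat functions and the bound of the global dual norm -/

namespace Mesh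

variable {β l r : ℝ} (M : Mesh l r) {i : ℕ} {f u v g : ℝ → ℝ}

/-- Guarantees that orthogonality is available at every vertex where a mean value is subtracted. -/
lemma x_mem_of_notMem_outflow (hβ : β ≠ 0) (hi : i ≤ M.n) (ho : M.x i ∉ outflow β l r) :
    M.x i ∈ Ioo l r ∨ M.x i ∈ inflow β l r := by
  rcases (M.le_x hi).eq_or_lt with h1 | h1
  · right
    rcases hβ.lt_or_gt with hb | hb
    · exact absurd ((mem_outflow_of_neg hb).2 h1.symm) ho
    · exact (mem_inflow_of_pos hb).2 h1.symm
  rcases (M.x_le_right_end hi).eq_or_lt with h2 | h2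
  · right
    rcases hβ.lt_or_gt with hb | hb
    · exact (mem_inflow_of_neg hb).2 h2
    · exact absurd ((mem_outflow_of_pos hb).2 h2) ho
  · exact Or.inl ⟨h1, h2⟩

/-- On a patch at the outflow boundary of `Ω`, the outflow boundaries of `Ω` and of the patch
share the vertex. -/
lemma x_mem_outflow_patch (hβ : β ≠ 0) (hi : i ≤ M.n) (ho : M.x i ∈ outflow β l r) :
    M.x i ∈ outflow β (M.left i) (M.right i) := by
  rcases hβ.lt_or_gt with hb | hb
  · rw [mem_outflow_of_neg hb] at ho ⊢
    exact le_antisymm (ho.le.trans (M.le_left hi)) (M.left_le hi)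
  · rw [mem_outflow_of_pos hb] at ho ⊢
    exact le_antisymm (M.le_right hi) (M.right_le.trans ho.symm.le)

/-- The cut-off of `v - c` by a hat function. -/
lemma memPatchSpace_hat_mul (hβ : β ≠ 0) (hlr : l < r) (hi : i ≤ M.n)
    (h : MemH1 (M.left i) (M.right i) v g) {c : ℝ}
    (hc : M.x i ∈ outflow β l r → ZeroTrace (M.left i) (M.right i) (fun x => v x - c) (M.x i)) :
    M.MemPatchSpace β i (fun x => M.hat i x * (v x - c))
      (fun x => deriv (M.hat i) x * (v x - c) + M.hat i x * g x) := by
  have hLR := M.left_lt_right hlr hi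
  have hL := M.le_left hi
  have hR := M.right_le (i := i)
  obtain ⟨w, hw, hvw⟩ := h.exists_hasACDeriv hLR
  have hw' := hw.add_const (-c)
  have hT := M.hasACDeriv_tent hi hL hLR.le hR
  have hTw := hT.mul hw'
  have hcont := hTw.continuousOn hLR.le
  have hvc : (fun x => v x - c) =ᵐ[volume.restrict (Ioo (M.left i) (M.right i))]
      fun x => w x + -c := by
    filter_upwards [hvw] with x hx
    rw [hx, sub_eq_add_neg]
  have hsub := Ioo_subset_Ioo hL hR
  have hp : (fun x => M.hat i x * (v x - c)) =ᵐ[volume.restrict (Ioo (M.left i) (M.right i))]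
      fun x => M.tent i x * (w x + -c) := by
    filter_upwards [hvc, ae_restrict_mem measurableSet_Ioo] with x hx hm
    rw [hx, M.hat_eq_tent hi (hsub hm)]
  have hq : (fun x => deriv (M.hat i) x * (w x + -c) + M.tent i x * g x)
      =ᵐ[volume.restrict (Ioo (M.left i) (M.right i))]
      fun x => deriv (M.hat i) x * (v x - c) + M.hat i x * g x := by
    filter_upwards [hvc, ae_restrict_mem measurableSet_Ioo] with x hx hm
    rw [hx, M.hat_eq_tent hi (hsub hm)]
  have hq2 : MemL2 (M.left i) (M.right i)
      (fun x => deriv (M.hat i) x * (v x - c) + M.hat i x * g x) := by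
    refine MemL2.add ?_ ?_
    · exact (h.1.sub (memL2_const c)).mul_of_bound (measurable_deriv _).aestronglyMeasurable
        (ae_restrict_of_ae_restrict_of_subset hsub (M.ae_abs_deriv_hat_le hi))
    · refine h.2.1.mul_of_bound ((M.aestronglyMeasurable_hat hi).mono_set hsub) (C := 1) ?_
      filter_upwards [ae_restrict_mem measurableSet_Ioo] with x hx
      exact M.abs_hat_le_one hi (hsub hx)
  have hH1 := (hTw.congr_deriv hq).memH1 hLR.le hq2 hp
  have hwx : M.x i ∈ outflow β l r → w (M.x i) + -c = 0 := fun ho =>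
    (hc ho).eq_zero (w := fun x => w x + -c) hLR (hw'.continuousOn hLR.le) hvc ⟨M.left_le hi, M.le_right hi⟩
  -- Either the hat vanishes at this end, or the end is the vertex itself and `v - c` vanishes
  -- there.
  have hzl : (M.left i < M.x i ∨ M.x i ∈ outflow β l r) →
      ZeroTrace (M.left i) (M.right i) (fun x => M.hat i x * (v x - c)) (M.left i) := by
    intro h0
    refine ⟨_, hcont, hp, ?_⟩
    rcases (M.left_le hi).eq_or_lt with he | hlt
    · have ho := h0.resolve_left he.not_lt
      simp only [he, hwx ho, mul_zero]
    · simp only [M.tent_left hlt, zero_mul]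
  have hzr : (M.x i < M.right i ∨ M.x i ∈ outflow β l r) →
      ZeroTrace (M.left i) (M.right i) (fun x => M.hat i x * (v x - c)) (M.right i) := by
    intro h0
    refine ⟨_, hcont, hp, ?_⟩
    rcases (M.le_right hi).eq_or_lt with he | hlt
    · have ho := h0.resolve_left he.not_lt
      simp only [← he, hwx ho, mul_zero]
    · simp only [M.tent_right hlt, zero_mul]
  refine ⟨fun hin => ⟨hH1, fun d hd => ?_⟩, fun hin => ?_⟩
  · rcases hβ.lt_or_gt with hb | hb
    · rw [mem_inflow_of_neg hb] at hin
      rw [(mem_outflow_of_neg hb).1 hd]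
      exact hzl (Or.inl (M.left_lt hi (hlr.trans_le hin.symm.le)))
    · rw [mem_inflow_of_pos hb] at hin
      rw [(mem_outflow_of_pos hb).1 hd]
      exact hzr (Or.inl (M.lt_right hi (hin.le.trans_lt hlr)))
  · by_cases ho : M.x i ∈ outflow β l r
    · exact ⟨hH1, hzl (Or.inr ho), hzr (Or.inr ho)⟩
    · have hm := (M.x_mem_of_notMem_outflow hβ hi ho).resolve_right hin
      exact ⟨hH1, hzl (Or.inl (M.left_lt hi hm.1)), hzr (Or.inl (M.lt_right hi hm.2))⟩

/-- Product rule with `|ψ| ≤ 1`; it is applied with `K = h C_PF`, giving one term of the maximum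
`C_cont,PF`. -/
lemma l2norm_hat_mul_le (hi : i ≤ M.n) {K : ℝ} (hv : MemL2 (M.left i) (M.right i) v)
    (hg : MemL2 (M.left i) (M.right i) g)
    (hK : l2norm (M.left i) (M.right i) v ≤ K * l2norm (M.left i) (M.right i) g) :
    l2norm (M.left i) (M.right i) (fun x => deriv (M.hat i) x * v x + M.hat i x * g x) ≤
      (1 + K * M.hatGradSup i) * l2norm (M.left i) (M.right i) g := by
  have hsub := Ioo_subset_Ioo (M.le_left hi) (M.right_le (i := i))
  have hd := ae_restrict_of_ae_restrict_of_subset hsub (M.ae_abs_deriv_hat_le hi)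
  have hb : ∀ᵐ x ∂volume.restrict (Ioo (M.left i) (M.right i)), |M.hat i x| ≤ 1 := by
    filter_upwards [ae_restrict_mem measurableSet_Ioo] with x hx
    exact M.abs_hat_le_one hi (hsub hx)
  have h1 : l2norm (M.left i) (M.right i) (fun x => deriv (M.hat i) x * v x) ≤
      M.hatGradSup i * l2norm (M.left i) (M.right i) v := by
    refine l2norm_le_of_ae_abs_le_mul (M.hatGradSup_nonneg i) hv ?_
    filter_upwards [hd] with x hx
    rw [abs_mul]
    exact mul_le_mul_of_nonneg_right hx (abs_nonneg _)
  have h2 : l2norm (M.left i) (M.right i) (fun x => M.hat i x * g x) ≤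
      1 * l2norm (M.left i) (M.right i) g := by
    refine l2norm_le_of_ae_abs_le_mul zero_le_one hg ?_
    filter_upwards [hb] with x hx
    rw [abs_mul]
    exact mul_le_mul_of_nonneg_right hx (abs_nonneg _)
  have h3 := l2norm_add_le
    (hv.mul_of_bound (measurable_deriv _).aestronglyMeasurable hd)
    (hg.mul_of_bound ((M.aestronglyMeasurable_hat hi).mono_set hsub) hb)
  nlinarith [mul_le_mul_of_nonneg_left hK (M.hatGradSup_nonneg i)]

lemma memL2_hat (hi : i ≤ M.n) : MemL2 l r (M.hat i) := by
  refine MemLp.of_bound (M.aestronglyMeasurable_hat hi) 1 ?_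
  filter_upwards [ae_restrict_mem measurableSet_Ioo] with x hx using M.abs_hat_le_one hi hx

lemma memL2_deriv_hat (hi : i ≤ M.n) : MemL2 l r (deriv (M.hat i)) :=
  MemLp.of_bound (measurable_deriv _).aestronglyMeasurable _ (M.ae_abs_deriv_hat_le hi)

lemma memL2_hat_mul (hi : i ≤ M.n) (hv : MemL2 l r v) :
    MemL2 l r (fun x => M.hat i x * v x) := by
  refine hv.mul_of_bound (M.aestronglyMeasurable_hat hi) (C := 1) ?_
  filter_upwards [ae_restrict_mem measurableSet_Ioo] with x hx using M.abs_hat_le_one hi hx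

lemma memL2_deriv_hat_mul (hi : i ≤ M.n) (hv : MemL2 l r v) :
    MemL2 l r (fun x => deriv (M.hat i) x * v x) :=
  hv.mul_of_bound (measurable_deriv _).aestronglyMeasurable (M.ae_abs_deriv_hat_le hi)

/-- The part of the residual localized by a hat function is controlled by the local dual norm. -/
lemma residual_hat_mul_le (hβ : β ≠ 0) (hlr : l < r) (hi : i ≤ M.n) (hf : MemL2 l r f)
    (hu : MemL2 l r u) (horth : M.HatOrthogonal β f u) (h : MemH1plus β l r v g) :
    residual β l r f u (fun x => M.hat i x * v x)
      (fun x => deriv (M.hat i) x * v x + M.hat i x * g x) ≤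
    |M.localDualNorm β f u i| *
      (M.cContPF β * l2norm (M.left i) (M.right i) (fun x => β * g x)) := by
  have hLR := M.left_lt_right hlr hi
  have hL := M.le_left hi
  have hR := M.right_le (i := i)
  have hPF := M.isPFConst_cPF hlr hβ hi
  obtain ⟨z, hz, hvz⟩ := h.1.exists_hasACDeriv hlr
  have hvz' := ae_restrict_of_ae_restrict_of_subset (Ioo_subset_Ioo hL hR) hvz
  have hH1 : MemH1 (M.left i) (M.right i) v g :=
    (hz.mono hL hLR.le hR).memH1 hLR.le (h.1.2.1.mono hL hR) hvz'
  have htrace : M.x i ∈ outflow β l r → ZeroTrace (M.left i) (M.right i) v (M.x i) := by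
    intro ho
    refine ⟨z, (hz.mono hL hLR.le hR).continuousOn hLR.le, hvz', ?_⟩
    exact (h.2 _ ho).eq_zero hlr (hz.continuousOn hlr.le) hvz ⟨M.le_x hi, M.x_le_right_end hi⟩
  -- Take `c = 0` at the outflow vertex, where `v` vanishes, and the patch mean elsewhere, where
  -- orthogonality removes `c ψ`.
  obtain ⟨c, hc1, hc2, hc3⟩ : ∃ c : ℝ,
      (M.x i ∈ outflow β l r → ZeroTrace (M.left i) (M.right i) (fun x => v x - c) (M.x i)) ∧
      c * residual β l r f u (M.hat i) (deriv (M.hat i)) = 0 ∧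
      l2norm (M.left i) (M.right i) (fun x => v x - c) ≤
        (M.right i - M.left i) * M.cPF β i * l2norm (M.left i) (M.right i) g := by
    by_cases ho : M.x i ∈ outflow β l r
    · refine ⟨0, fun _ => by simpa using htrace ho, zero_mul _, ?_⟩
      simp only [sub_zero]
      refine hPF.2.2 ho v g ⟨hH1, fun d hd => ?_⟩
      obtain ⟨e, -, he⟩ := exists_outflow_eq hβ hLR.le
      rw [(he d).1 hd, ← (he _).1 (M.x_mem_outflow_patch hβ hi ho)]
      exact htrace ho
    · refine ⟨mean (M.left i) (M.right i) v, fun ho' => absurd ho' ho, ?_, hPF.2.1 ho v g hH1⟩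
      rw [horth i (Finset.mem_range.2 (Nat.lt_succ_iff.2 hi))
        (M.x_mem_of_notMem_outflow hβ hi ho), mul_zero]
  have hmem := M.memPatchSpace_hat_mul hβ hlr hi hH1 hc1
  set p : ℝ → ℝ := fun x => M.hat i x * (v x - c) with hp
  set q : ℝ → ℝ := fun x => deriv (M.hat i) x * (v x - c) + M.hat i x * g x with hq
  have e1 : (fun x => M.hat i x * v x) =ᵐ[volume.restrict (Ioo l r)]
      fun x => M.zeroExt i p x + c * M.hat i x := by
    filter_upwards [ae_restrict_mem measurableSet_Ioo] with x hx
    rw [zeroExt]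
    by_cases hm : x ∈ Ioo (M.left i) (M.right i)
    · rw [indicator_of_mem hm, hp]
      ring
    · rw [indicator_of_notMem hm, M.hat_eq_zero hi hx hm]
      ring
  have e2 : (fun x => deriv (M.hat i) x * v x + M.hat i x * g x) =ᵐ[volume.restrict (Ioo l r)]
      fun x => M.zeroExt i q x + c * deriv (M.hat i) x := by
    filter_upwards [ae_restrict_mem measurableSet_Ioo, M.ae_deriv_hat_eq_zero hi] with x hx hd
    rw [zeroExt]
    by_cases hm : x ∈ Ioo (M.left i) (M.right i)
    · rw [indicator_of_mem hm, hq]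
      ring
    · rw [indicator_of_notMem hm, M.hat_eq_zero hi hx hm, hd hm]
      ring
  have hext := hmem.memH1plus_zeroExt hβ hlr hi
  rw [residual_congr e1 e2, residual_add hf hu hext.1.1 ((M.memL2_hat hi).const_mul c)
    hext.1.2.1 ((M.memL2_deriv_hat hi).const_mul c), residual_const_mul, hc2, add_zero]
  refine (M.residual_le_localDualNorm_mul hβ hlr hi hf hu hmem).trans ?_
  -- The absolute value avoids showing that the local dual norm is nonnegative; it disappears on
  -- squaring.
  refine mul_le_mul (le_abs_self _) ?_ (l2norm_nonneg _ _ _) (abs_nonneg _)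
  rw [l2norm_const_mul, l2norm_const_mul, mul_left_comm]
  refine mul_le_mul_of_nonneg_left ?_ (abs_nonneg β)
  refine (M.l2norm_hat_mul_le hi (hH1.1.sub (memL2_const c)) hH1.2.1 hc3).trans ?_
  refine mul_le_mul_of_nonneg_right ?_ (l2norm_nonneg _ _ _)
  rw [mul_comm (M.right i - M.left i)]
  exact Finset.le_sup' (fun i => 1 + M.cPF β i * (M.right i - M.left i) * M.hatGradSup i)
    (Finset.mem_range.2 (Nat.lt_succ_iff.2 hi))

/-- The hats sum to one and their derivatives to zero, so the product-rule terms add up to `g`. -/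
lemma residual_eq_sum_hat (hlr : l < r) (hf : MemL2 l r f) (hu : MemL2 l r u)
    (h : MemH1 l r v g) :
    residual β l r f u v g = ∑ i ∈ Finset.range (M.n + 1),
      residual β l r f u (fun x => M.hat i x * v x)
        (fun x => deriv (M.hat i) x * v x + M.hat i x * g x) := by
  have hi : ∀ i ∈ Finset.range (M.n + 1), i ≤ M.n := fun i hi =>
    Nat.lt_succ_iff.1 (Finset.mem_range.1 hi)
  rw [← residual_sum _ hf hu (fun i h' => M.memL2_hat_mul (hi i h') h.1)
    (fun i h' => (M.memL2_deriv_hat_mul (hi i h') h.1).add (M.memL2_hat_mul (hi i h') h.2.1))]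
  refine residual_congr ?_ ?_
  · filter_upwards [ae_restrict_mem measurableSet_Ioo] with x hx
    rw [← Finset.sum_mul, M.sum_hat hx, one_mul]
  · filter_upwards [ae_restrict_mem measurableSet_Ioo, M.ae_sum_deriv_hat hlr.le] with x hx hd
    rw [Finset.sum_add_distrib, ← Finset.sum_mul, ← Finset.sum_mul, M.sum_hat hx, hd, one_mul,
      zero_mul, zero_add]

/-- Under orthogonality to the hat functions, the localized dual norms bound the global one. -/
lemma globalDualNorm_sq_le (hβ : β ≠ 0) (hlr : l < r) (hf : MemL2 l r f) (hu : MemL2 l r u)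
    (horth : M.HatOrthogonal β f u) :
    globalDualNorm β l r f u ^ 2 ≤
      2 * M.cContPF β ^ 2 * ∑ i ∈ Finset.range (M.n + 1), M.localDualNorm β f u i ^ 2 := by
  set D := ∑ i ∈ Finset.range (M.n + 1), M.localDualNorm β f u i ^ 2 with hD
  have hD0 : 0 ≤ D := Finset.sum_nonneg fun i _ => sq_nonneg _
  have hB : 0 ≤ 2 * M.cContPF β ^ 2 * D := by positivity
  rw [← Real.le_sqrt (globalDualNorm_nonneg hβ hlr hf hu) hB]
  refine Real.sSup_le ?_ (Real.sqrt_nonneg _)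
  rintro t ⟨v, g, h, -, rfl⟩
  refine div_le_of_le_mul₀ (l2norm_nonneg _ _ _) (Real.sqrt_nonneg _) ?_
  have h1 : residual β l r f u v g ≤ ∑ i ∈ Finset.range (M.n + 1), |M.localDualNorm β f u i| *
      (M.cContPF β * l2norm (M.left i) (M.right i) (fun x => β * g x)) := by
    rw [M.residual_eq_sum_hat hlr hf hu h.1]
    exact Finset.sum_le_sum fun i hi => M.residual_hat_mul_le hβ hlr
      (Nat.lt_succ_iff.1 (Finset.mem_range.1 hi)) hf hu horth h
  refine h1.trans (abs_le_of_sq_le_sq' ?_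
    (mul_nonneg (Real.sqrt_nonneg _) (l2norm_nonneg _ _ _))).2
  -- Cauchy–Schwarz over the vertices; the overlap bound on the patch norms of `β ∇v` then supplies
  -- the factor 2.
  refine (Finset.sum_mul_sq_le_sq_mul_sq _ _ _).trans ?_
  simp only [sq_abs, mul_pow, ← Finset.mul_sum]
  rw [Real.sq_sqrt hB]
  have h2 := M.sum_l2norm_sq_le (h.1.2.1.const_mul β)
  have h3 := mul_le_mul_of_nonneg_left h2 (mul_nonneg hD0 (sq_nonneg (M.cContPF β)))
  linarith

end Mesh

end Advection

/-- Localizability of residual dual norms. The first three clauses say that the constants and the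
suprema in the two estimates are well defined. -/
theorem theorem4p3 (l r : ℝ) (hlr : l < r) (β : ℝ) (hβ : β ≠ 0) (f u : ℝ → ℝ)
    (hf : Advection.MemL2 l r f) (hu : Advection.MemL2 l r u) (M : Advection.Mesh l r) :
    (∀ i ∈ Finset.range (M.n + 1), M.IsPFConst β i (M.cPF β i) ∧ M.cPF β i ≤ 1) ∧
    BddAbove (Advection.globalQuotients β l r f u) ∧
    (∀ i ∈ Finset.range (M.n + 1), BddAbove (M.localQuotients β f u i)) ∧
    (M.HatOrthogonal β f u →
      (Advection.globalDualNorm β l r f u) ^ 2 ≤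
        2 * (M.cContPF β) ^ 2 *
          ∑ i ∈ Finset.range (M.n + 1), (M.localDualNorm β f u i) ^ 2) ∧
    ∑ i ∈ Finset.range (M.n + 1), (M.localDualNorm β f u i) ^ 2 ≤
      2 * (Advection.globalDualNorm β l r f u) ^ 2 := by
  have hi : ∀ i ∈ Finset.range (M.n + 1), i ≤ M.n := fun i h =>
    Nat.lt_succ_iff.1 (Finset.mem_range.1 h)
  exact ⟨fun i h => ⟨M.isPFConst_cPF hlr hβ (hi i h), M.cPF_le_one hlr hβ (hi i h)⟩,
    Advection.bddAbove_globalQuotients hβ hlr hf hu,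
    fun i h => M.bddAbove_localQuotients hβ hlr (hi i h) hf hu,
    M.globalDualNorm_sq_le hβ hlr hf hu, M.sum_localDualNorm_sq_le hβ hlr hf hu⟩
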